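/- Let $1\le p\le n$ be integers and let $X_1,\dots,X_n$ be i.i.d. random variables on a probability space $(\Omega,\mathcal F,\mathbb P)$ with values in a measurable space $(E,\mathcal E)$. Let $f:E^n\to\mathbb R$ be measurable and $W=f(X_1,\dots,X_n)\in L^4(\mathbb P)$. Recall that $W$ has an a.s. unique Hoeffding decomposition $W=\sum_{J\subseteq\{1,\dots,n\}}W_J$ a.s., where the $W_J$ are integrable random variables such that $W_J$ is $\sigma(X_i,i\in J)$-measurable and, for all $J,K\subseteq\{1,\dots,n\}$, $\mathbb E[W_J\mid X_i,i\in K]=0$ a.s. unless $J\subseteq K$. Suppose that $W$ is a completely degenerate, symmetric $U$-statistic of order $p$, that is, $W_J=0$ a.s. whenever $|J|\neq p$, and there is one measurable symmetric function $\psi:E^p\to\mathbb R$ such that $W_J=\psi(X_{i_1},\dots,X_{i_p})$ a.s. for every $J=\{i_1<\dots<i_p\}\subseteq\{1,\dots,n\}$ with $|J|=p$. Suppose moreover that $\operatorname{Var}(W)=1$ (equivalently $\mathbb E[W^2]=1$, since then $\mathbb E[W]=0$). Then $$\sup_{t\in\mathbb R}\bigl|\mathbb P(W\le t)-\Phi(t)\bigr|\;\le\;12\sqrt{\bigl|\mathbb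 E[W^4]-3\bigr|}+19\,\frac{p}{\sqrt n},$$ where $\Phi$ is the distribution function of the standard normal distribution. -/

import Mathlib

open MeasureTheory ProbabilityTheory

/-- `σ(X_i, i ∈ J)`: the σ-algebra on `Ω` generated by the subfamily `(X_i)_{i ∈ J}`. -/
abbrev subfamilySigma {Ω : Type*} {n : ℕ} {E : Fin n → Type*} [mE : ∀ i, MeasurableSpace (E i)]
    (X : ∀ i, Ω → E i) (J : Finset (Fin n)) : MeasurableSpace Ω :=
  ⨆ i ∈ J, (mE i).comap (X i)

/-- `(H J)_{J ⊆ [n]}` is the (almost surely unique) Hoeffding decomposition of `W` with respect to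
the random variables `X_1, …, X_n`. Integrability of the components is recorded since the
conditional expectation of a non-integrable function is `0` by convention. -/
structure IsHoeffdingDecomposition {Ω : Type*} [MeasurableSpace Ω] {n : ℕ} {E : Fin n → Type*}
    [∀ i, MeasurableSpace (E i)] (X : ∀ i, Ω → E i) (μ : Measure Ω) (W : Ω → ℝ)
    (H : Finset (Fin n) → Ω → ℝ) : Prop where
  /-- `W = ∑_{J ⊆ [n]} W_J` almost surely -/
  eq_sum : W =ᵐ[μ] fun ω => ∑ J : Finset (Fin n), H J ω
  integrable : ∀ J, Integrable (H J) μ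
  /-- `W_J` is `σ(X_i, i ∈ J)`-measurable -/
  measurable : ∀ J, Measurable[subfamilySigma X J] (H J)
  /-- `E[W_J | X_i, i ∈ K] = 0` unless `J ⊆ K` -/
  condExp_eq_zero : ∀ J K, ¬ J ⊆ K → μ[H J | subfamilySigma X K] =ᵐ[μ] 0

/-- For random variables `X_1, …, X_n` with values in the same space `E`: the Hoeffding
decomposition of `W` consists of the terms `ψ(X_i, i ∈ J)` with `|J| = p` only, where `ψ` is one
measurable symmetric kernel on `E^p` that is the same for all `J`. The arguments of `ψ` are plugged
in in ascending order of the indices. -/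
def IsDegenerateSymmetricUStatistic {Ω E : Type*} [MeasurableSpace Ω] [MeasurableSpace E] {n : ℕ}
    (p : ℕ) (X : Fin n → Ω → E) (μ : Measure Ω) (W : Ω → ℝ) : Prop :=
  ∃ (H : Finset (Fin n) → Ω → ℝ) (ψ : (Fin p → E) → ℝ),
    IsHoeffdingDecomposition X μ W H ∧
    Measurable ψ ∧
    (∀ (s : Equiv.Perm (Fin p)) (x : Fin p → E), ψ (fun k => x (s k)) = ψ x) ∧
    (∀ J : Finset (Fin n), J.card ≠ p → H J =ᵐ[μ] 0) ∧
    (∀ (J : Finset (Fin n)) (hJ : J.card = p),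
      H J =ᵐ[μ] fun ω => ψ (fun k => X (J.orderEmbOfFin hJ k) ω))

/-! Only the joint law of the sample matters, so the argument lives on a product space. Let `W` be
the kernel sum, `W'` the same sum with coordinate `i` resampled, `D_i = W - W'`, and `E_i` the
average over coordinate `i`. The pair `(W, W')` is exchangeable, and degeneracy makes `W` an
eigenvector, with eigenvalue `p`, of `L = ∑ (1 - E_i)` (`sum_integral_mul_sub`). For the solution
`f` of Stein's equation this gives `p E[W f(W)] = ½ ∑ E[D_i (f(W) - f(W'))]`, and replacing the
increment of `f` by `D_i f'(W)` leaves two errors.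

The first is `E[f'(W) (1 - ∑ D_i² / (2p))]`. Write `W² = 1 + T + M`, where `T` collects the products
of kernels with disjoint index sets. Given the sample, `∑ D_i²` has mean `2p W² - L W²`. Since `L T
= 2p T`, the part `T` cancels and `M - L M / (2p)` remains. Its norm is at most `‖M‖`, because `M`
has degree at most `2p` (`norm_sub_sum_le`, resting on a reversed Efron-Stein inequality).

The second is the remainder of the linearisation. As `f'` is an increasing function plus a
decreasing one, exchangeability bounds the remainder by `∑ E[c(W) D_i |D_i|]` with `|c| ≤ 2`
(`abs_integral_increment_error_le`). Taking absolute values here would lose everything, since `∑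
E[D_i²] = 2p`. But `D_i |D_i|` is antisymmetric, so its conditional expectation `h_i` given the
sample satisfies `E_i h_i = 0`. Then `‖∑ h_i‖² ≤ ∑ ‖(1 - E_k) h_j‖²` (`norm_sum_sq_le`), and this is
at most `4p ∑ E[D_i⁴]`, because `D_j` is in turn degenerate of order `p - 1` in the other
coordinates.

The fourth moment controls both errors. By orthogonality `E[W⁴] = 1 + ‖T‖² + ‖M‖²`. Symmetry of the
kernel makes all mixed moments inside `‖T‖²` nonnegative (`inner_pairLp_nonneg`), and the diagonal
ones alone give `‖T‖² ≥ 2 (1 - p²/n)`. Hence `‖M‖² ≤ |E[W⁴] - 3| + 2p²/n`, and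
`fourth_moment_identity` bounds `∑ E[D_i⁴]` in the same way. -/

open Filter Topology

/-! ### Stein's equation for the standard normal distribution -/

/-- The density of the standard normal distribution. -/
noncomputable def stdPDF (x : ℝ) : ℝ := gaussianPDFReal 0 1 x

/-- The distribution function of the standard normal distribution. -/
noncomputable def stdCDF (x : ℝ) : ℝ := cdf (gaussianReal 0 1) x

lemma stdPDF_pos (x : ℝ) : 0 < stdPDF x := gaussianPDFReal_pos 0 1 x one_ne_zero

lemma stdPDF_eq (x : ℝ) : stdPDF x = (√(2 * Real.pi))⁻¹ * Real.exp (-x ^ 2 / 2) := by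
  simp [stdPDF, gaussianPDFReal]

lemma stdPDF_neg (x : ℝ) : stdPDF (-x) = stdPDF x := by simp [stdPDF_eq]

lemma stdPDF_le_one (x : ℝ) : stdPDF x ≤ 1 := by
  rw [stdPDF_eq]
  have h1 : (√(2 * Real.pi))⁻¹ ≤ 1 := by
    apply inv_le_one_of_one_le₀
    rw [Real.one_le_sqrt]
    nlinarith [Real.pi_gt_three]
  have h2 : Real.exp (-x ^ 2 / 2) ≤ 1 := Real.exp_le_one_iff.2 (by nlinarith [sq_nonneg x])
  exact mul_le_one₀ h1 (Real.exp_pos _).le h2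

lemma hasDerivAt_stdPDF (x : ℝ) : HasDerivAt stdPDF (-x * stdPDF x) x := by
  have h : HasDerivAt (fun x : ℝ => (√(2 * Real.pi))⁻¹ * Real.exp (-x ^ 2 / 2))
      ((√(2 * Real.pi))⁻¹ * (Real.exp (-x ^ 2 / 2) * (-(2 * x) / 2))) x := by
    have h0 : HasDerivAt (fun x : ℝ => -x ^ 2 / 2) (-(2 * x) / 2) x := by
      simpa using ((hasDerivAt_pow 2 x).neg.div_const 2)
    exact (h0.exp).const_mul _
  have e : stdPDF = fun x : ℝ => (√(2 * Real.pi))⁻¹ * Real.exp (-x ^ 2 / 2) := funext stdPDF_eq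
  rw [e]
  refine HasDerivAt.congr_deriv h ?_
  ring

lemma stdCDF_eq_integral (x : ℝ) : stdCDF x = ∫ t in Set.Iic x, stdPDF t := by
  rw [stdCDF, cdf_eq_real, measureReal_def, gaussianReal_apply_eq_integral 0 one_ne_zero,
    ENNReal.toReal_ofReal]
  · rfl
  · exact setIntegral_nonneg measurableSet_Iic fun t _ => (gaussianPDFReal_nonneg 0 1 t)

lemma continuous_stdPDF : Continuous stdPDF :=
  continuous_iff_continuousAt.2 fun x => (hasDerivAt_stdPDF x).continuousAt

lemma hasDerivAt_stdCDF (x : ℝ) : HasDerivAt stdCDF (stdPDF x) x := by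
  have hi : Integrable stdPDF := integrable_gaussianPDFReal 0 1
  have e : stdCDF = fun y => stdCDF 0 + ∫ t in (0 : ℝ)..y, stdPDF t := by
    funext y
    rw [← intervalIntegral.integral_Iic_sub_Iic hi.integrableOn hi.integrableOn,
      ← stdCDF_eq_integral, ← stdCDF_eq_integral]
    ring
  rw [e]
  exact (intervalIntegral.integral_hasDerivAt_right hi.intervalIntegrable
    (continuous_stdPDF.stronglyMeasurableAtFilter _ _) continuous_stdPDF.continuousAt).const_add _

lemma stdCDF_nonneg (x : ℝ) : 0 ≤ stdCDF x := cdf_nonneg _ x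
lemma stdCDF_le_one (x : ℝ) : stdCDF x ≤ 1 := cdf_le_one _ x
lemma tendsto_stdCDF_atTop : Tendsto stdCDF atTop (𝓝 1) := tendsto_cdf_atTop _
lemma tendsto_stdCDF_atBot : Tendsto stdCDF atBot (𝓝 0) := tendsto_cdf_atBot _

lemma stdCDF_neg (x : ℝ) : stdCDF (-x) = 1 - stdCDF x := by
  have hd : ∀ y, HasDerivAt (fun y => stdCDF y + stdCDF (-y)) 0 y := fun y => by
    have h := (hasDerivAt_stdCDF y).add ((hasDerivAt_stdCDF (-y)).comp y (hasDerivAt_neg y))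
    rw [stdPDF_neg] at h
    exact h.congr_deriv (by ring)
  have hc : ∀ y, stdCDF y + stdCDF (-y) = stdCDF x + stdCDF (-x) := fun y =>
    is_const_of_deriv_eq_zero (fun y => (hd y).differentiableAt) (fun y => (hd y).deriv) y x
  have h1 : Tendsto (fun y => stdCDF y + stdCDF (-y)) atTop (𝓝 (1 + 0)) :=
    tendsto_stdCDF_atTop.add (tendsto_stdCDF_atBot.comp tendsto_neg_atTop_atBot)
  have h2 := tendsto_nhds_unique h1 (tendsto_const_nhds.congr fun y => (hc y).symm)
  linarith

/-- Serves both Mills bounds: in each, the difference of the two sides, divided by a suitable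
positive factor, decreases to `0` at infinity. -/
lemma nonneg_of_antitoneOn_tendsto {G : ℝ → ℝ} {c : ℝ} (hG : AntitoneOn G (Set.Ioi c))
    (hl : Tendsto G atTop (𝓝 0)) {w : ℝ} (hw : c < w) : 0 ≤ G w :=
  ge_of_tendsto' (f := fun _ : ℝ => G w) (x := atTop) tendsto_const_nhds (fun _ => by
    refine le_of_tendsto hl ?_
    filter_upwards [eventually_ge_atTop w] with y hy
    exact hG hw (lt_of_lt_of_le hw hy) hy)

/-- Lower bound on Mills' ratio. -/
lemma mills_lower (w : ℝ) : w * stdPDF w ≤ (1 + w ^ 2) * (1 - stdCDF w) := by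
  set G : ℝ → ℝ := fun w => (1 - stdCDF w) - stdPDF w * (w / (1 + w ^ 2)) with hGdef
  have hd : ∀ w, HasDerivAt G (-2 * stdPDF w / (1 + w ^ 2) ^ 2) w := fun w => by
    have hne : (1 + w ^ 2) ≠ 0 := by positivity
    have h3 : HasDerivAt (fun w : ℝ => 1 + w ^ 2) (2 * w) w := by
      simpa using (hasDerivAt_pow 2 w).const_add 1
    have h4 := (hasDerivAt_id w).div h3 hne
    have h5 := ((hasDerivAt_stdCDF w).const_sub 1).sub ((hasDerivAt_stdPDF w).mul h4)
    refine HasDerivAt.congr_deriv h5 ?_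
    simp only [id, Pi.div_apply]
    field_simp
    ring
  have hG : Antitone G := antitone_of_deriv_nonpos (fun w => (hd w).differentiableAt) fun w => by
    rw [(hd w).deriv]
    have := stdPDF_pos w
    have : 0 ≤ 2 * stdPDF w / (1 + w ^ 2) ^ 2 := by positivity
    rw [neg_mul, neg_div]; linarith
  have hl : Tendsto G atTop (𝓝 0) := by
    have h1 : Tendsto (fun w => 1 - stdCDF w) atTop (𝓝 0) := by
      simpa using tendsto_stdCDF_atTop.const_sub 1
    have h2 : Tendsto (fun w : ℝ => stdPDF w * (w / (1 + w ^ 2))) atTop (𝓝 0) := by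
      refine squeeze_zero' ?_ ?_ tendsto_inv_atTop_zero
      · filter_upwards [eventually_ge_atTop 0] with w hw
        have := stdPDF_pos w
        positivity
      · filter_upwards [eventually_gt_atTop 0] with w hw
        have h6 : w / (1 + w ^ 2) ≤ w⁻¹ := by
          rw [div_le_iff₀ (by positivity), inv_mul_eq_div, le_div_iff₀ hw]; nlinarith
        calc stdPDF w * (w / (1 + w ^ 2)) ≤ 1 * (w / (1 + w ^ 2)) := by
              gcongr; exact stdPDF_le_one w
          _ ≤ _ := by rw [one_mul]; exact h6
    simpa using h1.sub h2
  have h0 := nonneg_of_antitoneOn_tendsto (c := w - 1) (hG.antitoneOn _) hl (by linarith : w - 1 < w)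
  simp only [hGdef] at h0
  have hp : 0 < 1 + w ^ 2 := by positivity
  have h7 : (1 + w ^ 2) * ((1 - stdCDF w) - stdPDF w * (w / (1 + w ^ 2)))
      = (1 + w ^ 2) * (1 - stdCDF w) - w * stdPDF w := by field_simp
  nlinarith [mul_nonneg hp.le h0]

/-- Upper bound on Mills' ratio. -/
lemma mills_upper (w : ℝ) : w * (1 - stdCDF w) ≤ stdPDF w := by
  rcases le_or_gt w 0 with hw | hw
  · have := stdPDF_pos w
    have := stdCDF_le_one w
    nlinarith
  set G : ℝ → ℝ := fun w => stdPDF w / w - (1 - stdCDF w) with hGdef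
  have hd : ∀ w, 0 < w → HasDerivAt G (-stdPDF w / w ^ 2) w := fun w hw => by
    have h5 := ((hasDerivAt_stdPDF w).div (hasDerivAt_id w) hw.ne').sub
      ((hasDerivAt_stdCDF w).const_sub 1)
    refine HasDerivAt.congr_deriv h5 ?_
    simp only [id]
    field_simp
    ring
  have hG : AntitoneOn G (Set.Ioi 0) := by
    refine antitoneOn_of_deriv_nonpos (convex_Ioi 0)
      (fun w hw => (hd w hw).continuousAt.continuousWithinAt)
      (fun w hw => ?_) fun w hw => ?_
    · rw [interior_Ioi] at hw
      exact (hd w hw).differentiableAt.differentiableWithinAt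
    · rw [interior_Ioi] at hw
      rw [(hd w hw).deriv]
      have := stdPDF_pos w
      have : 0 ≤ stdPDF w / w ^ 2 := by positivity
      rw [neg_div]; linarith
  have hl : Tendsto G atTop (𝓝 0) := by
    have h1 : Tendsto (fun w => 1 - stdCDF w) atTop (𝓝 0) := by
      simpa using tendsto_stdCDF_atTop.const_sub 1
    have h2 : Tendsto (fun w : ℝ => stdPDF w / w) atTop (𝓝 0) := by
      refine squeeze_zero' ?_ ?_ tendsto_inv_atTop_zero
      · filter_upwards [eventually_ge_atTop 0] with w hw
        have := stdPDF_pos w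
        positivity
      · filter_upwards [eventually_gt_atTop 0] with w hw
        rw [div_eq_mul_inv]
        have := stdPDF_le_one w
        have : 0 < w⁻¹ := by positivity
        nlinarith
    simpa using h2.sub h1
  have h0 := nonneg_of_antitoneOn_tendsto hG hl hw
  simp only [hGdef] at h0
  have h7 : w * (stdPDF w / w - (1 - stdCDF w)) = stdPDF w - w * (1 - stdCDF w) := by field_simp
  nlinarith [mul_nonneg hw.le h0]

/-- The solution of Stein's equation for the indicator of `(-∞, z]`. -/
noncomputable def steinSol (z w : ℝ) : ℝ :=
  if w ≤ z then (1 - stdCDF z) * (stdCDF w / stdPDF w) else stdCDF z * ((1 - stdCDF w) / stdPDF w)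

lemma hasDerivAt_lower (w : ℝ) :
    HasDerivAt (fun w => stdCDF w / stdPDF w) (1 + w * (stdCDF w / stdPDF w)) w := by
  have hp := (stdPDF_pos w).ne'
  refine HasDerivAt.congr_deriv ((hasDerivAt_stdCDF w).div (hasDerivAt_stdPDF w) hp) ?_
  field_simp
  ring

lemma hasDerivAt_upper (w : ℝ) :
    HasDerivAt (fun w => (1 - stdCDF w) / stdPDF w) (-1 + w * ((1 - stdCDF w) / stdPDF w)) w := by
  have hp := (stdPDF_pos w).ne'
  refine HasDerivAt.congr_deriv
    (((hasDerivAt_stdCDF w).const_sub 1).div (hasDerivAt_stdPDF w) hp) ?_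
  field_simp
  ring

/-- The numerator of the derivative is exactly the difference of the two sides of `mills_lower`. -/
lemma monotone_upper : Monotone fun w => w * ((1 - stdCDF w) / stdPDF w) := by
  have hd := fun w : ℝ => (hasDerivAt_id w).mul (hasDerivAt_upper w)
  refine monotone_of_deriv_nonneg (fun w => (hd w).differentiableAt) fun w => ?_
  have h := (hd w).deriv
  have e : (fun w => w * ((1 - stdCDF w) / stdPDF w)) =
    (id * fun w => (1 - stdCDF w) / stdPDF w) := rfl
  rw [e, h]
  have hp := stdPDF_pos w
  have h1 := mills_lower w
  have : 1 * ((1 - stdCDF w) / stdPDF w) + id w * (-1 + w * ((1 - stdCDF w) / stdPDF w))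
    = ((1 + w ^ 2) * (1 - stdCDF w) - w * stdPDF w) / stdPDF w := by
    simp only [id]; field_simp; ring
  rw [this]
  exact div_nonneg (by linarith) hp.le

lemma monotone_lower : Monotone fun w => w * (stdCDF w / stdPDF w) := by
  intro a b hab
  have h := monotone_upper (neg_le_neg hab)
  simp only [stdCDF_neg, stdPDF_neg] at h
  simp only [sub_sub_cancel] at h
  linarith

lemma upper_le_one (w : ℝ) : w * ((1 - stdCDF w) / stdPDF w) ≤ 1 := by
  rw [← mul_div_assoc, div_le_one (stdPDF_pos w)]
  exact mills_upper w

lemma neg_one_le_lower (w : ℝ) : -1 ≤ w * (stdCDF w / stdPDF w) := by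
  have h := upper_le_one (-w)
  simp only [stdCDF_neg, stdPDF_neg, sub_sub_cancel] at h
  linarith

lemma steinSol_of_le {z w : ℝ} (h : w ≤ z) :
    steinSol z w = (1 - stdCDF z) * (stdCDF w / stdPDF w) := if_pos h

lemma steinSol_of_ge {z w : ℝ} (h : z ≤ w) :
    steinSol z w = stdCDF z * ((1 - stdCDF w) / stdPDF w) := by
  rcases h.eq_or_lt with rfl | h
  · rw [steinSol_of_le le_rfl]; ring
  · exact if_neg (not_le.2 h)

/-- Both branches are monotone by the Mills bounds and agree at `z`. This splits the derivative of
the Stein solution into an increasing part and a decreasing indicator, so its increments can be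
bounded without smoothing the indicator. -/
lemma monotone_mul_steinSol (z : ℝ) : Monotone fun w => w * steinSol z w := by
  have h0 := stdCDF_nonneg z
  have h1 := stdCDF_le_one z
  have hl : ∀ a b, a ≤ b → b ≤ z → a * steinSol z a ≤ b * steinSol z b := fun a b hab hb => by
    rw [steinSol_of_le hb, steinSol_of_le (hab.trans hb)]
    have := mul_le_mul_of_nonneg_left (monotone_lower hab) (sub_nonneg.2 h1)
    simp only at this
    linarith
  have hu : ∀ a b, a ≤ b → z ≤ a → a * steinSol z a ≤ b * steinSol z b := fun a b hab ha => by
    rw [steinSol_of_ge ha, steinSol_of_ge (ha.trans hab)]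
    have := mul_le_mul_of_nonneg_left (monotone_upper hab) h0
    simp only at this
    linarith
  intro a b hab
  rcases le_total b z with hb | hb
  · exact hl a b hab hb
  rcases le_total a z with ha | ha
  · exact (hl a z ha le_rfl).trans (hu z b hb le_rfl)
  · exact hu a b hab ha

lemma mul_steinSol_le (z w : ℝ) : w * steinSol z w ≤ stdCDF z := by
  have h0 := stdCDF_nonneg z
  refine (monotone_mul_steinSol z (le_max_left w z)).trans ?_
  simp only
  rw [steinSol_of_ge (le_max_right w z)]
  have := mul_le_mul_of_nonneg_left (upper_le_one (max w z)) h0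
  linarith

lemma le_mul_steinSol (z w : ℝ) : stdCDF z - 1 ≤ w * steinSol z w := by
  have h0 := stdCDF_le_one z
  refine le_trans ?_ (monotone_mul_steinSol z (min_le_left w z))
  simp only
  rw [steinSol_of_le (min_le_right w z)]
  have := mul_le_mul_of_nonneg_left (neg_one_le_lower (min w z)) (sub_nonneg.2 h0)
  linarith

/-- The indicator of `(-∞, z]`. -/
noncomputable def indIic (z w : ℝ) : ℝ := if w ≤ z then 1 else 0

/-- The derivative of `steinSol z`, as prescribed by Stein's equation. -/
noncomputable def steinDeriv (z w : ℝ) : ℝ := w * steinSol z w + indIic z w - stdCDF z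

/-- The product `w * steinSol z w` lies between `stdCDF z - 1` and `stdCDF z`, an interval of length
one; in either case of the indicator the shift lands in `[-1, 1]`. -/
lemma abs_steinDeriv_le (z w : ℝ) : |steinDeriv z w| ≤ 1 := by
  have h0 := stdCDF_nonneg z
  have h1 := stdCDF_le_one z
  have h2 := mul_steinSol_le z w
  have h3 := le_mul_steinSol z w
  rw [abs_le]
  unfold steinDeriv indIic
  split_ifs with h
  · constructor <;> linarith
  · constructor <;> linarith

lemma continuous_steinSol (z : ℝ) : Continuous (steinSol z) := by
  unfold steinSol
  have h1 : Continuous fun w => stdCDF w / stdPDF w :=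
    continuous_iff_continuousAt.2 fun x => (hasDerivAt_lower x).continuousAt
  have h2 : Continuous fun w => (1 - stdCDF w) / stdPDF w :=
    continuous_iff_continuousAt.2 fun x => (hasDerivAt_upper x).continuousAt
  refine Continuous.if_le (continuous_const.mul h1) (continuous_const.mul h2)
    continuous_id continuous_const ?_
  rintro x rfl
  ring

/-- The right derivative of the Stein solution. -/
lemma hasDerivWithinAt_steinSol (z w : ℝ) :
    HasDerivWithinAt (steinSol z) (w * steinSol z w + (if w < z then 1 else 0) - stdCDF z)
      (Set.Ici w) w := by
  by_cases h : w < z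
  · have h1 : HasDerivAt (fun w => (1 - stdCDF z) * (stdCDF w / stdPDF w)) _ w :=
      (hasDerivAt_lower w).const_mul (1 - stdCDF z)
    have h2 : HasDerivAt (steinSol z) _ w := h1.congr_of_eventuallyEq (by
      filter_upwards [eventually_lt_nhds h] with y hy
      exact steinSol_of_le hy.le)
    refine h2.hasDerivWithinAt.congr_deriv ?_
    rw [if_pos h, steinSol_of_le h.le]
    ring
  · rw [not_lt] at h
    have h1 : HasDerivAt (fun w => stdCDF z * ((1 - stdCDF w) / stdPDF w)) _ w :=
      (hasDerivAt_upper w).const_mul (stdCDF z)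
    have h2 : HasDerivWithinAt (steinSol z) _ (Set.Ici w) w :=
      (h1.hasDerivWithinAt (s := Set.Ici w)).congr (fun y hy => steinSol_of_ge (h.trans hy))
        (steinSol_of_ge h)
    refine h2.congr_deriv ?_
    rw [if_neg (not_lt.2 h), steinSol_of_ge h]
    ring

/-- On `[a, b]` the increasing part of the derivative is at most its value at `b` and the decreasing
indicator at most its value at `a`; comparison with a line then integrates this. Right derivatives
suffice, which avoids the kink at `z`. -/
lemma steinSol_sub_le (z : ℝ) {a b : ℝ} (hab : a ≤ b) :
    steinSol z b - steinSol z a ≤ (b - a) * (b * steinSol z b + indIic z a - stdCDF z) := by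
  set c := b * steinSol z b + indIic z a - stdCDF z
  have hB : ∀ x : ℝ, HasDerivAt (fun x => steinSol z a + (x - a) * c) c x := fun x => by
    simpa using (((hasDerivAt_id x).sub_const a).mul_const c).const_add (steinSol z a)
  have h := image_le_of_deriv_right_le_deriv_boundary (continuous_steinSol z).continuousOn
    (fun x _ => hasDerivWithinAt_steinSol z x) (B := fun x => steinSol z a + (x - a) * c)
    (B' := fun _ => c) (a := a) (b := b) (by simp)
    (fun x _ => (hB x).continuousAt.continuousWithinAt) (fun x _ => (hB x).hasDerivWithinAt)
    (fun x hx => by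
      have h1 := monotone_mul_steinSol z hx.2.le
      simp only at h1
      have h2 : (if x < z then (1 : ℝ) else 0) ≤ indIic z a := by
        unfold indIic
        split_ifs with h3 h4 <;> first | linarith | (exfalso; linarith [hx.1])
      simp only [c]
      linarith) (Set.right_mem_Icc.2 hab)
  linarith

lemma le_steinSol_sub (z : ℝ) {a b : ℝ} (hab : a ≤ b) :
    (b - a) * (a * steinSol z a + indIic z b - stdCDF z) ≤ steinSol z b - steinSol z a := by
  set c := a * steinSol z a + indIic z b - stdCDF z
  have hB : ∀ x : ℝ, HasDerivAt (fun x => steinSol z a + (x - a) * c) c x := fun x => by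
    simpa using (((hasDerivAt_id x).sub_const a).mul_const c).const_add (steinSol z a)
  have h := image_le_of_deriv_right_le_deriv_boundary (f := fun x => steinSol z a + (x - a) * c)
    (f' := fun _ => c) (B := steinSol z)
    (fun x _ => (hB x).continuousAt.continuousWithinAt) (fun x _ => (hB x).hasDerivWithinAt)
    (a := a) (b := b) (by simp) (continuous_steinSol z).continuousOn
    (fun x _ => hasDerivWithinAt_steinSol z x)
    (fun x hx => by
      have h1 := monotone_mul_steinSol z hx.1
      simp only at h1
      -- The right derivative carries the strict indicator. The comparison only involves `x < b`, so
      -- `b ≤ z` does give `x < z`.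
      have h2 : indIic z b ≤ (if x < z then (1 : ℝ) else 0) := by
        unfold indIic
        split_ifs with h3 h4 <;> first | linarith | (exfalso; linarith [hx.2])
      simp only [c]
      linarith) (Set.right_mem_Icc.2 hab)
  linarith

/-- The weight that appears in the error term of the exchangeable pairs bound. -/
noncomputable def steinWeight (z w : ℝ) : ℝ := w * steinSol z w - indIic z w

lemma abs_steinWeight_le (z w : ℝ) : |steinWeight z w| ≤ 2 := by
  have h0 := stdCDF_nonneg z
  have h1 := stdCDF_le_one z
  have h2 := mul_steinSol_le z w
  have h3 := le_mul_steinSol z w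
  rw [abs_le]
  unfold steinWeight indIic
  split_ifs with h
  · constructor <;> linarith
  · constructor <;> linarith

/-- The constant is crude; the Lipschitz property only serves to put the Stein solution of the
kernel sum into `L⁴`. -/
lemma abs_steinSol_sub_le (z a b : ℝ) : |steinSol z a - steinSol z b| ≤ 3 * |a - b| := by
  have h0 := stdCDF_nonneg z
  have h1 := stdCDF_le_one z
  wlog hab : b ≤ a generalizing a b
  · rw [abs_sub_comm, abs_sub_comm a b]; exact this b a (not_le.1 hab).le
  have h2 := mul_steinSol_le z a
  have h3 := le_mul_steinSol z b
  have h4 := steinSol_sub_le z hab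
  have h5 := le_steinSol_sub z hab
  have hi : ∀ w, 0 ≤ indIic z w ∧ indIic z w ≤ 1 := fun w => by
    unfold indIic; split_ifs <;> norm_num
  rw [abs_of_nonneg (sub_nonneg.2 hab), abs_le]
  have hs := sub_nonneg.2 hab
  constructor
  · nlinarith [hi a, hi b, mul_nonneg hs (sub_nonneg.2 h3), mul_nonneg hs (hi a).1]
  · nlinarith [hi a, hi b, mul_nonneg hs (sub_nonneg.2 h2), mul_nonneg hs (sub_nonneg.2 (hi b).2)]

/-- The error in replacing the increment of the Stein solution by its derivative. -/
lemma stein_increment_upper (z a b : ℝ) :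
    (a - b) * (steinSol z a - steinSol z b) - (a - b) ^ 2 * steinDeriv z a ≤
      max (a - b) 0 ^ 2 * (indIic z b - indIic z a) +
      max (b - a) 0 ^ 2 * (b * steinSol z b - a * steinSol z a) := by
  rcases le_total b a with h | h
  · have h1 := steinSol_sub_le z h
    have hs := sub_nonneg.2 h
    rw [max_eq_left hs, max_eq_right (by linarith)]
    have := mul_le_mul_of_nonneg_left h1 hs
    unfold steinDeriv
    nlinarith
  · have h1 := steinSol_sub_le z h
    have hs := sub_nonneg.2 h
    rw [max_eq_left hs, max_eq_right (by linarith)]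
    have := mul_le_mul_of_nonneg_left h1 hs
    unfold steinDeriv
    nlinarith

/-- Writing the error as squared positive parts times differences `c a - c b` prepares for
exchangeability. The roles of `x * steinSol z x` and of the indicator are swapped relative to the
upper bound, so that after integration both bounds become plus and minus the same quantity. -/
lemma stein_increment_lower (z a b : ℝ) :
      -(max (a - b) 0 ^ 2 * (a * steinSol z a - b * steinSol z b)) -
      max (b - a) 0 ^ 2 * (indIic z a - indIic z b) ≤
    (a - b) * (steinSol z a - steinSol z b) - (a - b) ^ 2 * steinDeriv z a := by
  rcases le_total b a with h | h
  · have h1 := le_steinSol_sub z h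
    have hs := sub_nonneg.2 h
    rw [max_eq_left hs, max_eq_right (by linarith)]
    have := mul_le_mul_of_nonneg_left h1 hs
    unfold steinDeriv
    nlinarith
  · have h1 := le_steinSol_sub z h
    have hs := sub_nonneg.2 h
    rw [max_eq_left hs, max_eq_right (by linarith)]
    have := mul_le_mul_of_nonneg_left h1 hs
    unfold steinDeriv
    nlinarith

/-! ### Commuting families of orthogonal projections -/

section Projections

variable {H ι : Type*} [NormedAddCommGroup H] [InnerProductSpace ℝ H]

/-- A commuting family of orthogonal projections. -/
structure IsProjectionFamily (E : ι → H →ₗ[ℝ] H) : Prop where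
  symm : ∀ i x y, inner ℝ (E i x) y = inner ℝ x (E i y)
  idem : ∀ i x, E i (E i x) = E i x
  comm : ∀ i j x, E i (E j x) = E j (E i x)

/-- The span of the vectors that are fixed by all `E i`, `i ∈ s`, up to `m` exceptional indices. -/
def degreeLE (E : ι → H →ₗ[ℝ] H) (s : Finset ι) (m : ℕ) : Submodule ℝ H :=
  Submodule.span ℝ {v | ∃ M : Finset ι, M.card ≤ m ∧ ∀ i ∈ s, i ∉ M → E i v = v}

namespace IsProjectionFamily

variable {E : ι → H →ₗ[ℝ] H}

lemma inner_sub_sub (hE : IsProjectionFamily E) (i : ι) (x y : H) :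
    inner ℝ (x - E i x) (y - E i y) = inner ℝ x (y - E i y) := by
  have : inner ℝ (E i x) (y - E i y) = 0 := by
    rw [hE.symm, map_sub, hE.idem, sub_self, inner_zero_right]
  rw [inner_sub_left, this, sub_zero]

lemma norm_sub_sq (hE : IsProjectionFamily E) (i : ι) (x : H) :
    ‖x - E i x‖ ^ 2 = inner ℝ x (x - E i x) := by
  rw [← real_inner_self_eq_norm_sq, hE.inner_sub_sub]

lemma norm_sq_eq (hE : IsProjectionFamily E) (i : ι) (x : H) :
    ‖x‖ ^ 2 = ‖E i x‖ ^ 2 + ‖x - E i x‖ ^ 2 := by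
  rw [hE.norm_sub_sq, ← real_inner_self_eq_norm_sq, ← real_inner_self_eq_norm_sq, hE.symm, hE.idem,
    inner_sub_right]
  ring

/-- A sum of vectors `h i` with `E i (h i) = 0` is controlled by the differences of the `h i`. -/
lemma norm_sum_sq_le [Fintype ι] (hE : IsProjectionFamily E) (h : ι → H) (h0 : ∀ i, E i (h i) = 0) :
    ‖∑ i, h i‖ ^ 2 ≤ ∑ j, ∑ k, ‖h j - E k (h j)‖ ^ 2 := by
  have h1 : ∀ j k, inner ℝ (h j) (h k) ≤
      (‖h j - E k (h j)‖ ^ 2 + ‖h k - E j (h k)‖ ^ 2) / 2 := fun j k => by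
    -- Since `E k` kills `h k` and `E j` kills `h j`, the complementary projections can be inserted
    -- and moved across the inner product; commutation keeps `E j` vanishing on `h j - E k (h j)`.
    have e : inner ℝ (h j) (h k) = inner ℝ (h j - E k (h j)) (h k - E j (h k)) := by
      have e1 := hE.inner_sub_sub k (h j) (h k)
      rw [h0 k, sub_zero] at e1
      have e2 := hE.inner_sub_sub j (h k) (h j - E k (h j))
      rw [map_sub, h0 j, hE.comm j k, h0 j, map_zero, sub_zero, sub_zero] at e2
      rw [← e1, real_inner_comm, ← e2, real_inner_comm]
    rw [e]
    refine (real_inner_le_norm _ _).trans ?_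
    nlinarith [sq_nonneg (‖h j - E k (h j)‖ - ‖h k - E j (h k)‖)]
  rw [← real_inner_self_eq_norm_sq, sum_inner]
  simp_rw [inner_sum]
  calc ∑ j, ∑ k, inner ℝ (h j) (h k)
      ≤ ∑ j, ∑ k, (‖h j - E k (h j)‖ ^ 2 + ‖h k - E j (h k)‖ ^ 2) / 2 :=
        Finset.sum_le_sum fun j _ => Finset.sum_le_sum fun k _ => h1 j k
    _ = (∑ j, ∑ k, ‖h j - E k (h j)‖ ^ 2 + ∑ j, ∑ k, ‖h k - E j (h k)‖ ^ 2) / 2 := by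
        simp_rw [← Finset.sum_div, Finset.sum_add_distrib]
    _ = _ := by
        rw [Finset.sum_comm (f := fun j k => ‖h k - E j (h k)‖ ^ 2)]; ring

variable [DecidableEq ι]

/-- The Efron-Stein inequality is reversed on sums of functions of at most `m` variables. -/
lemma sum_norm_sub_sq_le (hE : IsProjectionFamily E) (s : Finset ι) :
    ∀ (m : ℕ) (S : H), S ∈ degreeLE E s m → ∑ i ∈ s, ‖S - E i S‖ ^ 2 ≤ m * ‖S‖ ^ 2 := by
  induction s using Finset.induction_on with
  | empty => intro m S _; simp; positivity
  | insert a s ha ih =>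
    intro m S hS
    rw [Finset.sum_insert ha]
    have hE1 : E a S ∈ degreeLE E s m := by
      have : degreeLE E (insert a s) m ≤ (degreeLE E s m).comap (E a) := by
        refine Submodule.span_le.2 ?_
        rintro v ⟨M, hM, hv⟩
        refine Submodule.subset_span ⟨M, hM, fun i hi hiM => ?_⟩
        rw [hE.comm, hv i (Finset.mem_insert_of_mem hi) hiM]
      exact this hS
    -- Induction over the coordinates: `S` splits orthogonally into `E a S`, which keeps the degree
    -- bound on `s`, and `S - E a S`, which loses one degree because `a` is used up. The additional
    -- term for `a` restores that lost unit.
    have hD : ∀ i, ‖S - E i S‖ ^ 2 =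
        ‖E a S - E i (E a S)‖ ^ 2 + ‖(S - E a S) - E i (S - E a S)‖ ^ 2 := fun i => by
      rw [hE.norm_sq_eq a (S - E i S), map_sub, hE.comm a i]
      congr 3
      rw [map_sub]
      abel
    have h1 := ih m _ hE1
    have h3 := hE.norm_sq_eq a S
    rw [Finset.sum_congr rfl fun i _ => hD i, Finset.sum_add_distrib]
    rcases m with _ | m
    · have h0 : S - E a S = 0 := by
        have : degreeLE E (insert a s) 0 ≤ LinearMap.ker (LinearMap.id - E a) := by
          refine Submodule.span_le.2 ?_
          rintro v ⟨M, hM, hv⟩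
          have : M = ∅ := Finset.card_eq_zero.1 (Nat.le_zero.1 hM)
          subst this
          simp [hv a (Finset.mem_insert_self a s) (Finset.notMem_empty a)]
        simpa using this hS
      rw [h0]
      simp only [map_zero, sub_zero, norm_zero]
      simp at h1 ⊢
      exact h1
    · have hD1 : S - E a S ∈ degreeLE E s m := by
        have : degreeLE E (insert a s) (m + 1) ≤
            (degreeLE E s m).comap (LinearMap.id - E a) := by
          refine Submodule.span_le.2 ?_
          rintro v ⟨M, hM, hv⟩
          by_cases haM : a ∈ M
          · refine Submodule.subset_span ⟨M.erase a, ?_, fun i hi hiM => ?_⟩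
            · rw [Finset.card_erase_of_mem haM]; omega
            · have hia : i ≠ a := fun h => ha (h ▸ hi)
              have hiM' : i ∉ M := fun h => hiM (Finset.mem_erase.2 ⟨hia, h⟩)
              have hvi := hv i (Finset.mem_insert_of_mem hi) hiM'
              simp only [LinearMap.sub_apply, LinearMap.id_apply, map_sub]
              rw [hE.comm i a, hvi]
          · have : (LinearMap.id - E a : H →ₗ[ℝ] H) v = 0 := by
              simp [hv a (Finset.mem_insert_self a s) haM]
            change (LinearMap.id - E a : H →ₗ[ℝ] H) v ∈ degreeLE E s m
            rw [this]
            exact Submodule.zero_mem _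
        exact this hS
      have h2 := ih m _ hD1
      push_cast at h1 ⊢
      nlinarith

variable [Fintype ι]

/-- On sums of functions of at most `m` variables, `1 - N / m` is a contraction,
where `N = ∑ i, (1 - E i)`. -/
lemma norm_sub_sum_le (hE : IsProjectionFamily E) {m : ℕ} (hm : 0 < m) {S : H}
    (hS : S ∈ degreeLE E Finset.univ m) :
    ‖S - (m : ℝ)⁻¹ • ∑ i, (S - E i S)‖ ≤ ‖S‖ := by
  have hm' : (0 : ℝ) < m := by exact_mod_cast hm
  set T := ∑ i, (S - E i S) with hT
  have hTm : T ∈ degreeLE E Finset.univ m := by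
    refine Submodule.sum_mem _ fun k _ => Submodule.sub_mem _ hS ?_
    have : degreeLE E Finset.univ m ≤ (degreeLE E Finset.univ m).comap (E k) := by
      refine Submodule.span_le.2 ?_
      rintro v ⟨M, hM, hv⟩
      refine Submodule.subset_span ⟨M, hM, fun i hi hiM => ?_⟩
      rw [hE.comm, hv i hi hiM]
    exact this hS
  have h1 : inner ℝ S T = ∑ i, ‖S - E i S‖ ^ 2 := by
    rw [hT, inner_sum]
    exact Finset.sum_congr rfl fun i _ => (hE.norm_sub_sq i S).symm
  have h2 := hE.sum_norm_sub_sq_le Finset.univ m T hTm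
  have h3 : ‖T‖ ^ 2 = ∑ i, inner ℝ (S - E i S) (T - E i T) := by
    rw [← real_inner_self_eq_norm_sq]
    conv_lhs => rw [hT]
    rw [sum_inner]
    refine Finset.sum_congr rfl fun i _ => ?_
    rw [real_inner_comm, ← hE.inner_sub_sub, real_inner_comm]
  -- The weights are chosen so that, after the reversed Efron-Stein inequality for `T`, the second
  -- terms sum to at most `‖T‖² / 2` and can be absorbed.
  have h4 : ∀ i, inner ℝ (S - E i S) (T - E i T) ≤
      m / 2 * ‖S - E i S‖ ^ 2 + (2 * m : ℝ)⁻¹ * ‖T - E i T‖ ^ 2 := fun i => by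
    refine (real_inner_le_norm _ _).trans ?_
    have := sq_nonneg (m * ‖S - E i S‖ - ‖T - E i T‖)
    have h5 : m / 2 * ‖S - E i S‖ ^ 2 + (2 * m : ℝ)⁻¹ * ‖T - E i T‖ ^ 2
      - ‖S - E i S‖ * ‖T - E i T‖ = (2 * m : ℝ)⁻¹ * (m * ‖S - E i S‖ - ‖T - E i T‖) ^ 2 := by
      field_simp; ring
    have : 0 ≤ (2 * m : ℝ)⁻¹ * (m * ‖S - E i S‖ - ‖T - E i T‖) ^ 2 := by positivity
    linarith
  have h5 : ‖T‖ ^ 2 ≤ m * inner ℝ S T := by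
    have h6 : ‖T‖ ^ 2 ≤ m / 2 * ∑ i, ‖S - E i S‖ ^ 2 + (2 * m : ℝ)⁻¹ * ∑ i, ‖T - E i T‖ ^ 2 := by
      rw [h3, Finset.mul_sum, Finset.mul_sum, ← Finset.sum_add_distrib]
      exact Finset.sum_le_sum fun i _ => h4 i
    have h7 : (2 * m : ℝ)⁻¹ * ∑ i, ‖T - E i T‖ ^ 2 ≤ (2 * m : ℝ)⁻¹ * (m * ‖T‖ ^ 2) := by
      gcongr
    have h8 : (2 * m : ℝ)⁻¹ * (m * ‖T‖ ^ 2) = ‖T‖ ^ 2 / 2 := by field_simp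
    rw [← h1] at h6
    linarith
  have h0 : 0 ≤ inner ℝ S T := by rw [h1]; positivity
  refine le_of_sq_le_sq ?_ (norm_nonneg _)
  rw [norm_sub_sq_real, inner_smul_right, norm_smul, mul_pow, Real.norm_eq_abs, sq_abs]
  have h9 : ((m : ℝ)⁻¹) ^ 2 * ‖T‖ ^ 2 ≤ ((m : ℝ)⁻¹) ^ 2 * (m * inner ℝ S T) := by gcongr
  have h10 : ((m : ℝ)⁻¹) ^ 2 * (m * inner ℝ S T) = (m : ℝ)⁻¹ * inner ℝ S T := by field_simp
  have h11 : 0 ≤ (m : ℝ)⁻¹ * inner ℝ S T := by positivity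
  linarith

end IsProjectionFamily

end Projections

/-! ### Resampling coordinates of a product space -/

section Resample

lemma MeasureTheory.MeasurePreserving.integral_comp_ae {α β : Type*} [MeasurableSpace α]
    [MeasurableSpace β] {μ : Measure α} {ν : Measure β} {f : α → β} (hf : MeasurePreserving f μ ν)
    {g : β → ℝ} (hg : AEStronglyMeasurable g ν) : ∫ x, g (f x) ∂μ = ∫ y, g y ∂ν := by
  have := integral_map hf.measurable.aemeasurable (f := g) (by rw [hf.map_eq]; exact hg)
  rw [hf.map_eq] at this
  exact this.symm

lemma sq_integral_le_integral_sq {α : Type*} [MeasurableSpace α] {μ : Measure α}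
    [IsProbabilityMeasure μ] {g : α → ℝ} (hg : MemLp g 2 μ) :
    (∫ x, g x ∂μ) ^ 2 ≤ ∫ x, g x ^ 2 ∂μ := by
  have h1 := variance_nonneg g μ
  rw [variance_eq_sub hg] at h1
  simpa using h1

lemma MeasureTheory.MemLp.integral_prod_right_two {α β : Type*} [MeasurableSpace α]
    [MeasurableSpace β] {μ : Measure α} {ρ : Measure β} [IsProbabilityMeasure μ]
    [IsProbabilityMeasure ρ] {F : α × β → ℝ} (hF : MemLp F 2 (μ.prod ρ)) :
    MemLp (fun x => ∫ y, F (x, y) ∂ρ) 2 μ := by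
  have hm : AEStronglyMeasurable (fun x => ∫ y, F (x, y) ∂ρ) μ := hF.1.integral_prod_right'
  rw [memLp_two_iff_integrable_sq hm]
  have hi := hF.integrable_sq
  refine Integrable.mono' hi.integral_prod_left (hm.pow 2) ?_
  filter_upwards [hi.prod_right_ae, hF.1.prodMk_left] with x hx hx'
  rw [Real.norm_of_nonneg (sq_nonneg _)]
  exact sq_integral_le_integral_sq ((memLp_two_iff_integrable_sq hx').2 hx)

variable {ι E : Type*} [DecidableEq ι]

/-- Replace the coordinates of `x` in `A` by those of `y`. -/
def resample (A : Finset ι) (x y : ι → E) : ι → E := fun i => if i ∈ A then y i else x i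

lemma resample_resample (A B : Finset ι) (x y z : ι → E) :
    resample B (resample A x y) z = resample (A ∪ B) x (resample B y z) := by
  funext i
  simp only [resample, Finset.mem_union]
  split_ifs <;> tauto

lemma resample_comm {A B : Finset ι} (h : Disjoint A B) (x y z : ι → E) :
    resample B (resample A x y) z = resample A (resample B x z) y := by
  funext i
  simp only [resample]
  split_ifs with h1 h2
  · exact absurd h1 (Finset.disjoint_left.1 h h2)
  all_goals rfl

lemma resample_exchange (A : Finset ι) (x y : ι → E) :
    resample A (resample A x y) (resample A y x) = x := by
  funext i
  simp only [resample]
  split_ifs <;> rfl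

variable [MeasurableSpace E] [Fintype ι]

omit [Fintype ι] in
lemma measurable_resample (A : Finset ι) :
    Measurable fun q : (ι → E) × (ι → E) => resample A q.1 q.2 := by
  refine measurable_pi_lambda _ fun i => ?_
  by_cases h : i ∈ A
  · simp only [resample, h, if_true]; fun_prop
  · simp only [resample, h, if_false]; fun_prop

/-- The law of a family of independent random variables with law `ν`. -/
noncomputable abbrev iidLaw (ι : Type*) [Fintype ι] (ν : Measure E) : Measure (ι → E) :=
  Measure.pi fun _ : ι => ν

variable {ν : Measure E} [IsProbabilityMeasure ν]

/-- Viewed as one family of pairs, the map swaps the pairs indexed by `A` and fixes the others,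
hence preserves the product law. This is the exchangeability of `x` and `resample A x y` on which
all symmetrisations rest. -/
lemma measurePreserving_exchange (A : Finset ι) :
    MeasurePreserving (fun q : (ι → E) × (ι → E) => (resample A q.1 q.2, resample A q.2 q.1))
      ((iidLaw ι ν).prod (iidLaw ι ν)) ((iidLaw ι ν).prod (iidLaw ι ν)) := by
  have h1 := measurePreserving_arrowProdEquivProdArrow E E ι (fun _ => ν) (fun _ => ν)
  have h2 : MeasurePreserving
      (fun (a : ι → E × E) i => (if i ∈ A then Prod.swap else id) (a i))
      (Measure.pi fun _ : ι => ν.prod ν) (Measure.pi fun _ : ι => ν.prod ν) :=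
    measurePreserving_pi (fun _ => ν.prod ν) (fun _ => ν.prod ν)
      (f := fun i => if i ∈ A then Prod.swap else id) fun i => by
        split_ifs
        · exact Measure.measurePreserving_swap
        · exact MeasurePreserving.id _
  have h3 := (h1.comp h2).comp (h1.symm _)
  convert h3 using 1
  funext q
  refine Prod.ext ?_ ?_ <;>
  · funext i
    simp only [Function.comp, resample, MeasurableEquiv.arrowProdEquivProdArrow,
      Equiv.arrowProdEquivProdArrow]
    by_cases h : i ∈ A
    · simp [h]
    · simp [h]

lemma measurePreserving_resample (A : Finset ι) :
    MeasurePreserving (fun q : (ι → E) × (ι → E) => resample A q.1 q.2)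
      ((iidLaw ι ν).prod (iidLaw ι ν)) (iidLaw ι ν) :=
  measurePreserving_fst.comp (measurePreserving_exchange A)

variable (ν) in
/-- The average over the coordinates in `A`. -/
noncomputable def avg (A : Finset ι) (u : (ι → E) → ℝ) (x : ι → E) : ℝ :=
  ∫ y, u (resample A x y) ∂(iidLaw ι ν)

lemma avg_congr {A : Finset ι} {u v : (ι → E) → ℝ} (h : u =ᵐ[iidLaw ι ν] v) :
    avg ν A u =ᵐ[iidLaw ι ν] avg ν A v := by
  have h1 := (measurePreserving_resample (ν := ν) A).quasiMeasurePreserving.ae_eq_comp h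
  have h2 := Measure.ae_ae_of_ae_prod h1
  filter_upwards [h2] with x hx
  exact integral_congr_ae hx

lemma MeasureTheory.MemLp.resample {u : (ι → E) → ℝ} {r : ENNReal} (hu : MemLp u r (iidLaw ι ν))
    (A : Finset ι) : MemLp (fun q : (ι → E) × (ι → E) => u (resample A q.1 q.2)) r
      ((iidLaw ι ν).prod (iidLaw ι ν)) :=
  hu.comp_measurePreserving (measurePreserving_resample A)

lemma memLp_avg {u : (ι → E) → ℝ} (hu : MemLp u 2 (iidLaw ι ν)) (A : Finset ι) :
    MemLp (avg ν A u) 2 (iidLaw ι ν) :=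
  (hu.resample A).integral_prod_right_two

lemma ae_integrable_resample {u : (ι → E) → ℝ} (hu : Integrable u (iidLaw ι ν)) (A : Finset ι) :
    ∀ᵐ x ∂(iidLaw ι ν), Integrable (fun y => u (resample A x y)) (iidLaw ι ν) :=
  ((measurePreserving_resample (ν := ν) A).integrable_comp_of_integrable hu).prod_right_ae

lemma avg_add {u v : (ι → E) → ℝ} (hu : Integrable u (iidLaw ι ν)) (hv : Integrable v (iidLaw ι ν))
    (A : Finset ι) : avg ν A (u + v) =ᵐ[iidLaw ι ν] avg ν A u + avg ν A v := by
  filter_upwards [ae_integrable_resample hu A, ae_integrable_resample hv A] with x h1 h2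
  exact integral_add h1 h2

/-- By `resample_resample`, two resamplings amount to one resampling of `A ∪ B` from a composite
copy, which again has the product law. -/
lemma avg_avg {u : (ι → E) → ℝ} (hu : Integrable u (iidLaw ι ν)) (A B : Finset ι) :
    avg ν A (avg ν B u) =ᵐ[iidLaw ι ν] avg ν (A ∪ B) u := by
  filter_upwards [ae_integrable_resample hu (A ∪ B)] with x hx
  simp only [avg, resample_resample]
  have hB := measurePreserving_resample (ν := ν) B
  rw [← hB.integral_comp_ae hx.1]
  rw [integral_prod]
  exact hB.integrable_comp_of_integrable hx

lemma integral_mul_avg {u v : (ι → E) → ℝ} (hu : MemLp u 2 (iidLaw ι ν))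
    (hv : MemLp v 2 (iidLaw ι ν)) (A : Finset ι) :
    ∫ x, u x * avg ν A v x ∂(iidLaw ι ν) =
      ∫ q, u q.1 * v (resample A q.1 q.2) ∂((iidLaw ι ν).prod (iidLaw ι ν)) := by
  rw [integral_prod]
  · simp only [avg, integral_const_mul]
  · exact (hu.comp_measurePreserving measurePreserving_fst).integrable_mul (hv.resample A)

lemma avg_eq_self {u : (ι → E) → ℝ} {A : Finset ι}
    (h : ∀ x y, u (resample A x y) = u x) : avg ν A u = u := by
  funext x
  simp [avg, h]

variable (ν) in
/-- The average over the coordinates in `A`, as an operator on `L²`. -/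
noncomputable def avgOp (A : Finset ι) : Lp ℝ 2 (iidLaw ι ν) →ₗ[ℝ] Lp ℝ 2 (iidLaw ι ν) where
  toFun f := (memLp_avg (Lp.memLp f) A).toLp _
  map_add' f g := by
    rw [← MemLp.toLp_add]
    refine MemLp.toLp_congr _ _ ?_
    exact (avg_congr (Lp.coeFn_add f g)).trans (avg_add ((Lp.memLp f).integrable one_le_two)
      ((Lp.memLp g).integrable one_le_two) A)
  map_smul' c f := by
    rw [RingHom.id_apply, ← MemLp.toLp_const_smul]
    refine MemLp.toLp_congr _ _ ?_
    refine (avg_congr (Lp.coeFn_smul c f)).trans (Filter.Eventually.of_forall fun x => ?_)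
    simp [avg, integral_const_mul]

lemma avgOp_toLp {u : (ι → E) → ℝ} (hu : MemLp u 2 (iidLaw ι ν)) (A : Finset ι) :
    avgOp ν A (hu.toLp u) = (memLp_avg hu A).toLp (avg ν A u) :=
  MemLp.toLp_congr (memLp_avg (Lp.memLp _) A) _ (avg_congr hu.coeFn_toLp)

lemma inner_toLp_toLp {α : Type*} [MeasurableSpace α] {μ : Measure α} {u v : α → ℝ}
    (hu : MemLp u 2 μ) (hv : MemLp v 2 μ) :
    inner ℝ (hu.toLp u) (hv.toLp v) = ∫ x, u x * v x ∂μ := by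
  rw [L2.inner_def]
  refine integral_congr_ae ?_
  filter_upwards [hu.coeFn_toLp, hv.coeFn_toLp] with x h1 h2
  rw [h1, h2]
  simp [mul_comm]

lemma norm_toLp_sq {α : Type*} [MeasurableSpace α] {μ : Measure α} {u : α → ℝ}
    (hu : MemLp u 2 μ) : ‖hu.toLp u‖ ^ 2 = ∫ x, u x ^ 2 ∂μ := by
  rw [← real_inner_self_eq_norm_sq, inner_toLp_toLp]
  simp only [sq]

lemma inner_avgOp {u v : (ι → E) → ℝ} (hu : MemLp u 2 (iidLaw ι ν)) (hv : MemLp v 2 (iidLaw ι ν))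
    (A : Finset ι) : inner ℝ (hu.toLp u) (avgOp ν A (hv.toLp v)) =
      ∫ q, u q.1 * v (resample A q.1 q.2) ∂((iidLaw ι ν).prod (iidLaw ι ν)) := by
  rw [avgOp_toLp, inner_toLp_toLp, integral_mul_avg hu hv]

lemma integral_exchange {F : (ι → E) × (ι → E) → ℝ} (A : Finset ι)
    (hF : AEStronglyMeasurable F ((iidLaw ι ν).prod (iidLaw ι ν))) :
    ∫ q, F (resample A q.1 q.2, resample A q.2 q.1) ∂((iidLaw ι ν).prod (iidLaw ι ν)) =
      ∫ q, F q ∂((iidLaw ι ν).prod (iidLaw ι ν)) :=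
  (measurePreserving_exchange A).integral_comp_ae hF

/-- Both sides are expectations of a function of the sample times a function of its resampled
version, and the pair is exchangeable. -/
lemma inner_avgOp_symm (A : Finset ι) (f g : Lp ℝ 2 (iidLaw ι ν)) :
    inner ℝ (avgOp ν A f) g = inner ℝ f (avgOp ν A g) := by
  have hf := Lp.memLp f
  have hg := Lp.memLp g
  rw [real_inner_comm, ← Lp.toLp_coeFn f hf, ← Lp.toLp_coeFn g hg, inner_avgOp, inner_avgOp]
  rw [← integral_exchange A]
  · refine integral_congr_ae (Filter.Eventually.of_forall fun q => ?_)
    simp only [resample_exchange]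
    ring
  · exact ((hg.comp_measurePreserving measurePreserving_fst).integrable_mul (hf.resample A)).1

lemma avgOp_avgOp (A B : Finset ι) (f : Lp ℝ 2 (iidLaw ι ν)) :
    avgOp ν A (avgOp ν B f) = avgOp ν (A ∪ B) f := by
  have hf := Lp.memLp f
  rw [← Lp.toLp_coeFn f hf, avgOp_toLp, avgOp_toLp, avgOp_toLp]
  exact MemLp.toLp_congr _ _ (avg_avg (hf.integrable one_le_two) A B)

lemma isProjectionFamily_avgOp :
    IsProjectionFamily fun i : ι => avgOp ν {i} where
  symm i x y := inner_avgOp_symm _ x y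
  idem i x := by rw [avgOp_avgOp, Finset.union_self]
  comm i j x := by rw [avgOp_avgOp, avgOp_avgOp, Finset.union_comm]

end Resample

/-! ### Families of degenerate kernels -/

section Degenerate

lemma MeasureTheory.MemLp.mul_four {α : Type*} [MeasurableSpace α] {μ : Measure α} {f g : α → ℝ}
    (hf : MemLp f 4 μ) (hg : MemLp g 4 μ) : MemLp (fun x => f x * g x) 2 μ := by
  have : ENNReal.HolderTriple 4 4 2 := ⟨by
    rw [← two_mul, show (4 : ENNReal) = 2 * 2 by norm_num,
      ENNReal.mul_inv (by simp) (by simp), ← mul_assoc,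
      ENNReal.mul_inv_cancel (by simp) (by simp), one_mul]⟩
  exact hg.mul hf

lemma MeasureTheory.MemLp.integrable_mul_two {α : Type*} [MeasurableSpace α] {μ : Measure α}
    {f g : α → ℝ} (hf : MemLp f 2 μ) (hg : MemLp g 2 μ) : Integrable (fun x => f x * g x) μ :=
  hf.integrable_mul hg

lemma MeasureTheory.MemLp.comp_fst_prod {α β : Type*} [MeasurableSpace α] [MeasurableSpace β]
    {μ : Measure α} {ρ : Measure β} [IsProbabilityMeasure ρ] [SFinite μ] {f : α → ℝ} {r : ENNReal}
    (hf : MemLp f r μ) : MemLp (fun q : α × β => f q.1) r (μ.prod ρ) :=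
  hf.comp_measurePreserving measurePreserving_fst

lemma MeasureTheory.MemLp.of_four {α : Type*} [MeasurableSpace α] {μ : Measure α}
    [IsProbabilityMeasure μ] {f : α → ℝ} (hf : MemLp f 4 μ) : MemLp f 2 μ :=
  hf.mono_exponent (by norm_num)

variable {ι E : Type*} [DecidableEq ι] [MeasurableSpace E] [Fintype ι]

/-- The completely degenerate kernels of order `p` in the coordinates `J`, all built from one
symmetric kernel. -/
structure IsDegenerateFamily (ν : Measure E) (p : ℕ) (w : Finset ι → (ι → E) → ℝ) : Prop where
  memLp : ∀ J, MemLp (w J) 4 (iidLaw ι ν)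
  eq_of_eqOn : ∀ J x y, (∀ i ∈ J, x i = y i) → w J x = w J y
  avg_eq_zero : ∀ J, ∀ i ∈ J, avg ν {i} (w J) =ᵐ[iidLaw ι ν] 0
  perm : ∀ (σ : Equiv.Perm ι) J x, w J (x ∘ σ) = w (J.map σ.toEmbedding) x
  eq_zero : ∀ J, J.card ≠ p → w J = 0

/-- The sum of all kernels. -/
def kernelSum (w : Finset ι → (ι → E) → ℝ) (x : ι → E) : ℝ := ∑ J, w J x

namespace IsDegenerateFamily

variable {ν : Measure E} [IsProbabilityMeasure ν] {p : ℕ} {w : Finset ι → (ι → E) → ℝ}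

omit [IsProbabilityMeasure ν] in
lemma resample_of_disjoint (hw : IsDegenerateFamily ν p w) {A J : Finset ι} (h : Disjoint A J)
    (x y : ι → E) : w J (resample A x y) = w J x :=
  hw.eq_of_eqOn _ _ _ fun i hi => by
    simp [resample, Finset.disjoint_right.1 h hi]

omit [IsProbabilityMeasure ν] in
lemma memLp_kernelSum (hw : IsDegenerateFamily ν p w) : MemLp (kernelSum w) 4 (iidLaw ι ν) :=
  memLp_finsetSum _ fun J _ => hw.memLp J

/-- Given the original sample, only the last factor is random, and degeneracy makes its mean zero.
Splitting the test function into an `L²` and an `L⁴` factor admits cubic test functions of the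
kernel sum. -/
lemma integral_mul_resample_eq_zero (hw : IsDegenerateFamily ν p w) {a b : (ι → E) → ℝ}
    (ha : MemLp a 2 (iidLaw ι ν)) (hb : MemLp b 4 (iidLaw ι ν)) {J : Finset ι} {i : ι}
    (hi : i ∈ J) : ∫ q, a q.1 * b q.1 * w J (resample {i} q.1 q.2)
      ∂((iidLaw ι ν).prod (iidLaw ι ν)) = 0 := by
  have hint : Integrable (fun q : (ι → E) × (ι → E) => a q.1 * b q.1 * w J (resample {i} q.1 q.2))
      ((iidLaw ι ν).prod (iidLaw ι ν)) := by
    simp_rw [mul_assoc]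
    exact ha.comp_fst_prod.integrable_mul_two (hb.comp_fst_prod.mul_four ((hw.memLp J).resample _))
  rw [integral_prod _ hint]
  refine integral_eq_zero_of_ae ?_
  filter_upwards [hw.avg_eq_zero J i hi] with x hx
  simp only [integral_const_mul]
  simp only [avg] at hx
  rw [hx]
  simp

/-- The kernel sum is an eigenvector, for the eigenvalue `p`, of the generator of the dynamics that
resamples one coordinate at a time. -/
lemma sum_integral_mul_sub (hw : IsDegenerateFamily ν p w) {a b : (ι → E) → ℝ}
    (ha : MemLp a 2 (iidLaw ι ν)) (hb : MemLp b 4 (iidLaw ι ν)) :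
    ∑ i, ∫ q, a q.1 * b q.1 * (kernelSum w q.1 - kernelSum w (resample {i} q.1 q.2))
      ∂((iidLaw ι ν).prod (iidLaw ι ν)) = p * ∫ x, a x * b x * kernelSum w x ∂(iidLaw ι ν) := by
  have hint0 : ∀ J, Integrable (fun x => a x * b x * w J x) (iidLaw ι ν) := fun J => by
    simp_rw [mul_assoc]
    exact ha.integrable_mul_two (hb.mul_four (hw.memLp J))
  have hint1 : ∀ J, Integrable (fun q : (ι → E) × (ι → E) => a q.1 * b q.1 * w J q.1)
      ((iidLaw ι ν).prod (iidLaw ι ν)) := fun J =>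
    measurePreserving_fst.integrable_comp_of_integrable (hint0 J)
  have hint2 : ∀ J i, Integrable (fun q : (ι → E) × (ι → E) =>
      a q.1 * b q.1 * w J (resample {i} q.1 q.2)) ((iidLaw ι ν).prod (iidLaw ι ν)) := fun J i => by
    simp_rw [mul_assoc]
    exact ha.comp_fst_prod.integrable_mul_two (hb.comp_fst_prod.mul_four ((hw.memLp J).resample _))
  -- Resampling a coordinate of `J` averages the kernel away, resampling any other leaves it
  -- unchanged. Summing over `i` counts the elements of `J`, which is where the eigenvalue `p` comes
  -- from.
  have key : ∀ J i, ∫ q, (a q.1 * b q.1 * w J q.1 - a q.1 * b q.1 * w J (resample {i} q.1 q.2))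
      ∂((iidLaw ι ν).prod (iidLaw ι ν)) =
      if i ∈ J then ∫ x, a x * b x * w J x ∂(iidLaw ι ν) else 0 := fun J i => by
    split_ifs with h
    · rw [integral_sub (hint1 J) (hint2 J i), hw.integral_mul_resample_eq_zero ha hb h, sub_zero]
      exact measurePreserving_fst.integral_comp_ae (hint0 J).1
    · have h' : Disjoint {i} J := Finset.disjoint_singleton_left.2 h
      simp [hw.resample_of_disjoint h']
  have e1 : ∀ i, ∫ q, a q.1 * b q.1 * (kernelSum w q.1 - kernelSum w (resample {i} q.1 q.2))
      ∂((iidLaw ι ν).prod (iidLaw ι ν)) =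
      ∑ J, if i ∈ J then ∫ x, a x * b x * w J x ∂(iidLaw ι ν) else 0 := fun i => by
    rw [← Finset.sum_congr rfl fun J _ => key J i, ← integral_finsetSum]
    · refine integral_congr_ae (Filter.Eventually.of_forall fun q => ?_)
      simp only [kernelSum, Finset.mul_sum, mul_sub, Finset.sum_sub_distrib]
    · exact fun J _ => (hint1 J).sub (hint2 J i)
  rw [Finset.sum_congr rfl fun i _ => e1 i, Finset.sum_comm]
  have e2 : ∀ J : Finset ι, (∑ i, if i ∈ J then ∫ x, a x * b x * w J x ∂(iidLaw ι ν) else 0) =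
      p * ∫ x, a x * b x * w J x ∂(iidLaw ι ν) := fun J => by
    rw [Finset.sum_ite_mem, Finset.univ_inter, Finset.sum_const, nsmul_eq_mul]
    by_cases h : J.card = p
    · rw [h]
    · rw [hw.eq_zero J h]; simp
  rw [Finset.sum_congr rfl fun J _ => e2 J, ← Finset.mul_sum, ← integral_finsetSum]
  · simp only [kernelSum, Finset.mul_sum]
  · exact fun J _ => hint0 J

/-- The increment of the kernel sum when coordinate `i` is resampled. -/
def increment (w : Finset ι → (ι → E) → ℝ) (i : ι) (q : (ι → E) × (ι → E)) : ℝ :=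
  kernelSum w q.1 - kernelSum w (resample {i} q.1 q.2)

lemma memLp_increment (hw : IsDegenerateFamily ν p w) (i : ι) :
    MemLp (increment w i) 4 ((iidLaw ι ν).prod (iidLaw ι ν)) :=
  hw.memLp_kernelSum.comp_fst_prod.sub (hw.memLp_kernelSum.resample _)

omit [MeasurableSpace E] in
lemma increment_exchange (i : ι) (q : (ι → E) × (ι → E)) :
    increment w i (resample {i} q.1 q.2, resample {i} q.2 q.1) = - increment w i q := by
  simp [increment, resample_exchange]

omit [IsProbabilityMeasure ν] in
lemma memLp_sq (hw : IsDegenerateFamily ν p w) :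
    MemLp (fun x => kernelSum w x * kernelSum w x) 2 (iidLaw ι ν) :=
  hw.memLp_kernelSum.mul_four hw.memLp_kernelSum

/-- The square of the kernel sum as an element of `L²`. -/
noncomputable def sqLp (hw : IsDegenerateFamily ν p w) : Lp ℝ 2 (iidLaw ι ν) :=
  hw.memLp_sq.toLp _

variable (ν) in
/-- The generator of the dynamics that resamples one coordinate at a time, up to sign. -/
noncomputable def gen (f : Lp ℝ 2 (iidLaw ι ν)) : Lp ℝ 2 (iidLaw ι ν) :=
  ∑ i, (f - avgOp ν {i} f)

/-- The carré-du-champ identity. -/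
lemma sum_integral_mul_increment_sq (hw : IsDegenerateFamily ν p w) {φ : (ι → E) → ℝ}
    (hφ : MemLp φ 2 (iidLaw ι ν)) :
    ∑ i, ∫ q, φ q.1 * increment w i q ^ 2 ∂((iidLaw ι ν).prod (iidLaw ι ν)) =
      2 * p * inner ℝ (hφ.toLp φ) hw.sqLp - inner ℝ (hφ.toLp φ) (gen ν hw.sqLp) := by
  have h4 := hw.memLp_kernelSum
  -- Pointwise, `(a - b)² = 2a(a - b) - (a² - b²)`; the first term is handled by the eigenvector
  -- identity, the second is the generator applied to the square.
  have h1 : ∀ i, ∫ q, φ q.1 * increment w i q ^ 2 ∂((iidLaw ι ν).prod (iidLaw ι ν)) =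
      2 * ∫ q, φ q.1 * kernelSum w q.1 *
        (kernelSum w q.1 - kernelSum w (resample {i} q.1 q.2)) ∂((iidLaw ι ν).prod (iidLaw ι ν))
      - inner ℝ (hφ.toLp φ) (hw.sqLp - avgOp ν {i} hw.sqLp) := fun i => by
    have hr := h4.resample (ν := ν) {i}
    have i1 : Integrable (fun q : (ι → E) × (ι → E) => φ q.1 * kernelSum w q.1 *
        (kernelSum w q.1 - kernelSum w (resample {i} q.1 q.2)))
        ((iidLaw ι ν).prod (iidLaw ι ν)) := by
      simp_rw [mul_assoc]
      exact hφ.comp_fst_prod.integrable_mul_two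
        (h4.comp_fst_prod.mul_four (h4.comp_fst_prod.sub hr))
    have i2 : Integrable (fun q : (ι → E) × (ι → E) => φ q.1 *
        (kernelSum w q.1 * kernelSum w q.1)) ((iidLaw ι ν).prod (iidLaw ι ν)) :=
      hφ.comp_fst_prod.integrable_mul_two hw.memLp_sq.comp_fst_prod
    have i3 : Integrable (fun q : (ι → E) × (ι → E) => φ q.1 *
        (kernelSum w (resample {i} q.1 q.2) * kernelSum w (resample {i} q.1 q.2)))
        ((iidLaw ι ν).prod (iidLaw ι ν)) :=
      hφ.comp_fst_prod.integrable_mul_two (hr.mul_four hr)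
    rw [inner_sub_right, sqLp, inner_avgOp, inner_toLp_toLp]
    rw [← (measurePreserving_fst (μ := iidLaw ι ν) (ν := iidLaw ι ν)).integral_comp_ae
      (hφ.integrable_mul_two hw.memLp_sq).1]
    have i4 := i2.sub i3
    simp only [Pi.sub_def] at i4
    rw [← integral_const_mul, ← integral_sub i2 i3, ← integral_sub (i1.const_mul 2) i4]
    refine integral_congr_ae (Filter.Eventually.of_forall fun q => ?_)
    simp only [increment]
    ring
  rw [Finset.sum_congr rfl fun i _ => h1 i, Finset.sum_sub_distrib, ← Finset.mul_sum,
    hw.sum_integral_mul_sub hφ h4, gen, inner_sum, sqLp, inner_toLp_toLp]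
  simp only [mul_assoc]

/-- The sum of the fourth moments of all increments. -/
noncomputable def incrementFourth (ν : Measure E) (w : Finset ι → (ι → E) → ℝ) : ℝ :=
  ∑ i, ∫ q, increment w i q ^ 4 ∂((iidLaw ι ν).prod (iidLaw ι ν))

/-- Test the eigenvector identity against the cube of the kernel sum, symmetrise by exchangeability
and use `(a³ - b³)(a - b) = 3/2 (a² + b²)(a - b)² - 1/2 (a - b)⁴`; the squared increments are then
evaluated by the carré-du-champ identity. -/
lemma fourth_moment_identity (hw : IsDegenerateFamily ν p w) :
    p * ‖hw.sqLp‖ ^ 2 = 3 / 2 * (2 * p * ‖hw.sqLp‖ ^ 2 - inner ℝ hw.sqLp (gen ν hw.sqLp))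
      - incrementFourth ν w / 4 := by
  have h4 := hw.memLp_kernelSum
  have hm := hw.sum_integral_mul_increment_sq hw.memLp_sq
  rw [show hw.memLp_sq.toLp _ = hw.sqLp from rfl, real_inner_self_eq_norm_sq] at hm
  have he := hw.sum_integral_mul_sub hw.memLp_sq h4
  have e0 : ‖hw.sqLp‖ ^ 2 = ∫ x, kernelSum w x * kernelSum w x * kernelSum w x * kernelSum w x
      ∂(iidLaw ι ν) := by
    rw [sqLp, norm_toLp_sq]
    congr 1; funext x; ring
  have h1 : ∀ i, ∫ q, kernelSum w q.1 * kernelSum w q.1 * kernelSum w q.1 *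
        (kernelSum w q.1 - kernelSum w (resample {i} q.1 q.2)) ∂((iidLaw ι ν).prod (iidLaw ι ν)) =
      3 / 2 * (∫ q, kernelSum w q.1 * kernelSum w q.1 * increment w i q ^ 2
        ∂((iidLaw ι ν).prod (iidLaw ι ν))) -
      (∫ q, increment w i q ^ 4 ∂((iidLaw ι ν).prod (iidLaw ι ν))) / 4 := fun i => by
    have hr := h4.resample (ν := ν) {i}
    have hd := hw.memLp_increment i
    have hf := h4.comp_fst_prod (ρ := iidLaw ι ν)
    have i1 : Integrable (fun q : (ι → E) × (ι → E) => kernelSum w q.1 * kernelSum w q.1 *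
        kernelSum w q.1 * (kernelSum w q.1 - kernelSum w (resample {i} q.1 q.2)))
        ((iidLaw ι ν).prod (iidLaw ι ν)) := by
      simp_rw [mul_assoc (_ * _)]
      exact (hf.mul_four hf).integrable_mul_two (hf.mul_four hd)
    have i2 : Integrable (fun q : (ι → E) × (ι → E) => kernelSum w q.1 * kernelSum w q.1 *
        increment w i q ^ 2) ((iidLaw ι ν).prod (iidLaw ι ν)) := by
      simp_rw [sq]
      exact (hf.mul_four hf).integrable_mul_two (hd.mul_four hd)
    have i3 : Integrable (fun q : (ι → E) × (ι → E) => increment w i q ^ 4)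
        ((iidLaw ι ν).prod (iidLaw ι ν)) := by
      have := (hd.mul_four hd).integrable_mul_two (hd.mul_four hd)
      refine this.congr (Filter.Eventually.of_forall fun q => ?_)
      simp only; ring
    have s1 := integral_exchange {i} i1.1
    have s2 := integral_exchange {i} i2.1
    have j1 := (measurePreserving_exchange (ν := ν) {i}).integrable_comp_of_integrable i1
    have j2 := (measurePreserving_exchange (ν := ν) {i}).integrable_comp_of_integrable i2
    have t1 := integral_add i1 j1
    have t2 := integral_add i2 j2
    simp only [Function.comp_def] at t1 t2
    rw [s1] at t1
    rw [s2] at t2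
    have t3 := integral_sub (((i2.add j2).const_mul (3 / 4))) (i3.const_mul (1 / 4))
    rw [integral_const_mul, integral_const_mul] at t3
    simp only [Pi.add_apply, Function.comp_def] at t3
    rw [t2] at t3
    have t4 : ∫ q : (ι → E) × (ι → E), 3 / 4 * (kernelSum w q.1 * kernelSum w q.1 *
        increment w i q ^ 2 + kernelSum w (resample {i} q.1 q.2) *
          kernelSum w (resample {i} q.1 q.2) *
          increment w i (resample {i} q.1 q.2, resample {i} q.2 q.1) ^ 2) -
        1 / 4 * increment w i q ^ 4 ∂((iidLaw ι ν).prod (iidLaw ι ν)) =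
      1 / 2 * (∫ q : (ι → E) × (ι → E), (kernelSum w q.1 * kernelSum w q.1 * kernelSum w q.1 *
        (kernelSum w q.1 - kernelSum w (resample {i} q.1 q.2)) +
        kernelSum w (resample {i} q.1 q.2) * kernelSum w (resample {i} q.1 q.2) *
        kernelSum w (resample {i} q.1 q.2) * (kernelSum w (resample {i} q.1 q.2) -
          kernelSum w (resample {i} (resample {i} q.1 q.2) (resample {i} q.2 q.1))))
        ∂((iidLaw ι ν).prod (iidLaw ι ν))) := by
      rw [← integral_const_mul]
      refine integral_congr_ae (Filter.Eventually.of_forall fun q => ?_)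
      simp only [increment_exchange, resample_exchange]
      simp only [increment]
      ring
    rw [t3, t1] at t4
    linarith
  rw [Finset.sum_congr rfl fun i _ => h1 i, Finset.sum_sub_distrib, ← Finset.mul_sum, hm,
    ← Finset.sum_div, ← e0] at he
  rw [← he, incrementFourth]

end IsDegenerateFamily

end Degenerate

/-! ### Splitting the squared kernel sum into constant, top-degree and remaining parts. -/

section Decomposition

/-- Two disjoint finite sets of the same size are exchanged by an involution that fixes all other
points. -/
lemma exists_involutive_perm {ι : Type*} [DecidableEq ι] {B C : Finset ι} (hBC : Disjoint B C)
    (hc : B.card = C.card) : ∃ σ : Equiv.Perm ι, (∀ i, σ (σ i) = i) ∧ (∀ i ∈ B, σ i ∈ C) ∧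
      (∀ i ∈ C, σ i ∈ B) ∧ ∀ i, i ∉ B → i ∉ C → σ i = i := by
  let e : B ≃ C := Finset.equivOfCardEq hc
  let g : ι → ι := fun i => if h : i ∈ B then e ⟨i, h⟩ else if h : i ∈ C then e.symm ⟨i, h⟩ else i
  have hB : ∀ i (h : i ∈ B), g i = e ⟨i, h⟩ := fun i h => dif_pos h
  have hC : ∀ i (h : i ∈ C), g i = e.symm ⟨i, h⟩ := fun i h => by
    simp only [g]
    rw [dif_neg (Finset.disjoint_right.1 hBC h), dif_pos h]
  have hN : ∀ i, i ∉ B → i ∉ C → g i = i := fun i h h' => by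
    simp only [g]
    rw [dif_neg h, dif_neg h']
  have hg : ∀ i, g (g i) = i := fun i => by
    by_cases h : i ∈ B
    · rw [hB i h, hC _ (e ⟨i, h⟩).2]; simp
    by_cases h' : i ∈ C
    · rw [hC i h', hB _ (e.symm ⟨i, h'⟩).2]; simp
    · rw [hN i h h', hN i h h']
  refine ⟨⟨g, g, hg, hg⟩, hg, fun i h => ?_, fun i h => ?_, hN⟩
  · change g i ∈ C
    rw [hB i h]; exact (e ⟨i, h⟩).2
  · change g i ∈ B
    rw [hC i h]; exact (e.symm ⟨i, h⟩).2

variable {ι E : Type*} [DecidableEq ι] [MeasurableSpace E] [Fintype ι]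

omit [DecidableEq ι] in
lemma measurePreserving_perm {ν : Measure E} [IsProbabilityMeasure ν] (σ : Equiv.Perm ι) :
    MeasurePreserving (fun x : ι → E => x ∘ σ) (iidLaw ι ν) (iidLaw ι ν) := by
  have h := measurePreserving_piCongrLeft (fun _ : ι => ν) σ.symm
  convert h using 1
  funext x
  funext i
  have := MeasurableEquiv.piCongrLeft_apply_apply (β := fun _ : ι => E) σ.symm x (σ i)
  simpa using this.symm

namespace IsDegenerateFamily

variable {ν : Measure E} [IsProbabilityMeasure ν] {p : ℕ} {w : Finset ι → (ι → E) → ℝ}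

/-- The product of two kernels as an element of `L²`. -/
noncomputable def pairLp (hw : IsDegenerateFamily ν p w) (J K : Finset ι) : Lp ℝ 2 (iidLaw ι ν) :=
  ((hw.memLp J).mul_four (hw.memLp K)).toLp _

variable (ι ν) in
/-- The constant function `1` as an element of `L²`. -/
noncomputable def oneLp : Lp ℝ 2 (iidLaw ι ν) := (memLp_const (1 : ℝ)).toLp _

lemma avgOp_oneLp (A : Finset ι) : avgOp ν A (oneLp ι ν) = oneLp ι ν := by
  rw [oneLp, avgOp_toLp]
  refine MemLp.toLp_congr _ _ (Filter.Eventually.of_forall fun x => ?_)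
  simp [avg]

omit [DecidableEq ι] in
lemma norm_oneLp : ‖oneLp ι ν‖ ^ 2 = 1 := by
  rw [oneLp, norm_toLp_sq]; simp

omit [IsProbabilityMeasure ν] in
lemma pairLp_comm (hw : IsDegenerateFamily ν p w) (J K : Finset ι) :
    hw.pairLp J K = hw.pairLp K J :=
  MemLp.toLp_congr _ _ (Filter.Eventually.of_forall fun _ => mul_comm _ _)

omit [IsProbabilityMeasure ν] in
lemma pairLp_eq_zero (hw : IsDegenerateFamily ν p w) {J K : Finset ι}
    (h : J.card ≠ p ∨ K.card ≠ p) : hw.pairLp J K = 0 := by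
  rw [← MemLp.toLp_zero (MemLp.zero : MemLp (0 : (ι → E) → ℝ) 2 (iidLaw ι ν))]
  refine MemLp.toLp_congr _ _ (Filter.Eventually.of_forall fun x => ?_)
  rcases h with h | h
  · simp [hw.eq_zero J h]
  · simp [hw.eq_zero K h]

lemma avgOp_pairLp_of_notMem (hw : IsDegenerateFamily ν p w) {J K : Finset ι} {i : ι}
    (hJ : i ∉ J) (hK : i ∉ K) : avgOp ν {i} (hw.pairLp J K) = hw.pairLp J K := by
  rw [pairLp, avgOp_toLp]
  refine MemLp.toLp_congr _ _ (Filter.Eventually.of_forall fun x => ?_)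
  rw [avg_eq_self]
  intro x y
  simp only [hw.resample_of_disjoint (Finset.disjoint_singleton_left.2 hJ),
    hw.resample_of_disjoint (Finset.disjoint_singleton_left.2 hK)]

lemma avgOp_pairLp_left (hw : IsDegenerateFamily ν p w) {J K : Finset ι} {i : ι}
    (hJ : i ∈ J) (hK : i ∉ K) : avgOp ν {i} (hw.pairLp J K) = 0 := by
  rw [pairLp, avgOp_toLp]
  rw [← MemLp.toLp_zero (MemLp.zero : MemLp (0 : (ι → E) → ℝ) 2 (iidLaw ι ν))]
  refine MemLp.toLp_congr _ _ ?_
  filter_upwards [hw.avg_eq_zero J i hJ] with x hx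
  simp only [avg] at hx ⊢
  simp only [hw.resample_of_disjoint (Finset.disjoint_singleton_left.2 hK), integral_mul_const]
  rw [hx]
  simp

lemma avgOp_pairLp_of_disjoint (hw : IsDegenerateFamily ν p w) {J K : Finset ι} {i : ι}
    (hd : Disjoint J K) (h : i ∈ J ∪ K) : avgOp ν {i} (hw.pairLp J K) = 0 := by
  rcases Finset.mem_union.1 h with h | h
  · exact hw.avgOp_pairLp_left h (Finset.disjoint_left.1 hd h)
  · rw [pairLp_comm]
    exact hw.avgOp_pairLp_left h (Finset.disjoint_right.1 hd h)

lemma inner_eq_zero_of_avgOp {f g : Lp ℝ 2 (iidLaw ι ν)} {i : ι} (hf : avgOp ν {i} f = 0)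
    (hg : avgOp ν {i} g = g) : inner ℝ f g = 0 := by
  rw [← hg, ← inner_avgOp_symm, hf, inner_zero_left]

lemma gen_add (f g : Lp ℝ 2 (iidLaw ι ν)) : gen ν (f + g) = gen ν f + gen ν g := by
  simp only [gen, map_add, ← Finset.sum_add_distrib]
  exact Finset.sum_congr rfl fun _ _ => by abel

lemma gen_sum {κ : Type*} (s : Finset κ) (f : κ → Lp ℝ 2 (iidLaw ι ν)) :
    gen ν (∑ k ∈ s, f k) = ∑ k ∈ s, gen ν (f k) := by
  simp only [gen, map_sum, ← Finset.sum_sub_distrib]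
  exact Finset.sum_comm

lemma gen_oneLp : gen ν (oneLp ι ν) = 0 := by simp [gen, avgOp_oneLp]

lemma inner_gen_symm (f g : Lp ℝ 2 (iidLaw ι ν)) : inner ℝ (gen ν f) g = inner ℝ f (gen ν g) := by
  simp only [gen, sum_inner, inner_sum, inner_sub_left, inner_sub_right, inner_avgOp_symm]

lemma inner_gen_nonneg (f : Lp ℝ 2 (iidLaw ι ν)) : 0 ≤ inner ℝ f (gen ν f) := by
  rw [gen, inner_sum]
  refine Finset.sum_nonneg fun i _ => ?_
  rw [← isProjectionFamily_avgOp.norm_sub_sq]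
  positivity

lemma gen_pairLp_of_disjoint (hw : IsDegenerateFamily ν p w) {J K : Finset ι}
    (hd : Disjoint J K) : gen ν (hw.pairLp J K) = (2 * p : ℝ) • hw.pairLp J K := by
  by_cases h : J.card ≠ p ∨ K.card ≠ p
  · simp [hw.pairLp_eq_zero h, gen]
  push Not at h
  have e : ∀ i, hw.pairLp J K - avgOp ν {i} (hw.pairLp J K) =
      if i ∈ J ∪ K then hw.pairLp J K else 0 := fun i => by
    split_ifs with hi
    · rw [hw.avgOp_pairLp_of_disjoint hd hi, sub_zero]
    · rw [Finset.mem_union, not_or] at hi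
      rw [hw.avgOp_pairLp_of_notMem hi.1 hi.2, sub_self]
  rw [gen, Finset.sum_congr rfl fun i _ => e i, Finset.sum_ite_mem, Finset.univ_inter,
    Finset.sum_const, Finset.card_union_of_disjoint hd, h.1, h.2, ← two_mul,
    ← Nat.cast_smul_eq_nsmul ℝ]
  push_cast
  rfl

/-- The pairs of disjoint index sets of size `p`. -/
def disjointPairs (ι : Type*) [DecidableEq ι] [Fintype ι] (p : ℕ) :
    Finset (Finset ι × Finset ι) :=
  Finset.univ.filter fun a => (a.1.card = p ∧ a.2.card = p) ∧ Disjoint a.1 a.2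

/-- The pairs of intersecting index sets of size `p`. -/
def meetingPairs (ι : Type*) [DecidableEq ι] [Fintype ι] (p : ℕ) :
    Finset (Finset ι × Finset ι) :=
  Finset.univ.filter fun a => (a.1.card = p ∧ a.2.card = p) ∧ ¬ Disjoint a.1 a.2

/-- The component of the squared kernel sum of the top degree `2 p`. -/
noncomputable def topLp (hw : IsDegenerateFamily ν p w) : Lp ℝ 2 (iidLaw ι ν) :=
  ∑ a ∈ disjointPairs ι p, hw.pairLp a.1 a.2

/-- The part of the squared kernel sum of positive degree less than `2 p`. -/
noncomputable def midLp (hw : IsDegenerateFamily ν p w) : Lp ℝ 2 (iidLaw ι ν) :=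
  (∑ a ∈ meetingPairs ι p, hw.pairLp a.1 a.2) - oneLp ι ν

lemma toLp_finset_sum {α κ : Type*} [MeasurableSpace α] {μ : Measure α} (s : Finset κ)
    (f : κ → α → ℝ) (hf : ∀ k, MemLp (f k) 2 μ) (h : MemLp (fun x => ∑ k ∈ s, f k x) 2 μ) :
    h.toLp _ = ∑ k ∈ s, (hf k).toLp (f k) := by
  classical
  induction s using Finset.induction_on with
  | empty =>
    rw [Finset.sum_empty, ← MemLp.toLp_zero (MemLp.zero : MemLp (0 : α → ℝ) 2 μ)]
    exact MemLp.toLp_congr _ _ (Filter.Eventually.of_forall fun x => by simp)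
  | insert a s ha ih =>
    have hs : MemLp (fun x => ∑ k ∈ s, f k x) 2 μ := memLp_finsetSum _ fun k _ => hf k
    rw [Finset.sum_insert ha, ← ih hs, ← MemLp.toLp_add]
    exact MemLp.toLp_congr _ _ (Filter.Eventually.of_forall fun x => by simp [ha])

lemma sqLp_eq (hw : IsDegenerateFamily ν p w) : hw.sqLp = oneLp ι ν + hw.topLp + hw.midLp := by
  have h1 : hw.sqLp = ∑ a : Finset ι × Finset ι, hw.pairLp a.1 a.2 := by
    have hs : MemLp (fun x => ∑ a : Finset ι × Finset ι, w a.1 x * w a.2 x) 2 (iidLaw ι ν) :=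
      memLp_finsetSum _ fun a _ => (hw.memLp a.1).mul_four (hw.memLp a.2)
    have h2 := toLp_finset_sum Finset.univ (fun (a : Finset ι × Finset ι) x => w a.1 x * w a.2 x)
      (fun a => (hw.memLp a.1).mul_four (hw.memLp a.2)) hs
    refine Eq.trans (MemLp.toLp_congr _ _ (Filter.Eventually.of_forall fun x => ?_)) h2
    simp only [kernelSum, Finset.sum_mul_sum, Fintype.sum_prod_type]
  have h2 : ∑ a : Finset ι × Finset ι, hw.pairLp a.1 a.2 =
      ∑ a : Finset ι × Finset ι with a.1.card = p ∧ a.2.card = p, hw.pairLp a.1 a.2 := by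
    rw [Finset.sum_filter]
    refine Finset.sum_congr rfl fun a _ => ?_
    split_ifs with h
    · rfl
    · exact hw.pairLp_eq_zero (by tauto)
  rw [h1, h2, ← Finset.sum_filter_add_sum_filter_not _ (fun a => Disjoint a.1 a.2),
    Finset.filter_filter, Finset.filter_filter, topLp, midLp, disjointPairs, meetingPairs]
  abel

/-- Averaging over an index of `J ∪ K` outside `J' ∪ K'` kills the first product and fixes the
second. -/
lemma inner_pairLp_eq_zero (hw : IsDegenerateFamily ν p w) {J K J' K' : Finset ι}
    (hd : Disjoint J K) (h : ¬ (J ∪ K ⊆ J' ∪ K')) :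
    inner ℝ (hw.pairLp J K) (hw.pairLp J' K') = 0 := by
  obtain ⟨i, hi, hi'⟩ := Finset.not_subset.1 h
  rw [Finset.mem_union, not_or] at hi'
  exact inner_eq_zero_of_avgOp (hw.avgOp_pairLp_of_disjoint hd hi)
    (hw.avgOp_pairLp_of_notMem hi'.1 hi'.2)

/-- A disjoint pair occupies `2p` indices and an intersecting pair fewer, so the former always has
an index that the latter lacks. -/
lemma inner_pairLp_meeting (hw : IsDegenerateFamily ν p w) {a b : Finset ι × Finset ι}
    (ha : a ∈ disjointPairs ι p) (hb : b ∈ meetingPairs ι p) :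
    inner ℝ (hw.pairLp a.1 a.2) (hw.pairLp b.1 b.2) = 0 := by
  simp only [disjointPairs, meetingPairs, Finset.mem_filter, Finset.mem_univ, true_and] at ha hb
  refine hw.inner_pairLp_eq_zero ha.2 fun h => ?_
  have h1 := Finset.card_le_card h
  rw [Finset.card_union_of_disjoint ha.2] at h1
  have h2 := Finset.card_union_add_card_inter b.1 b.2
  have h3 : 0 < (b.1 ∩ b.2).card :=
    Finset.card_pos.2 (Finset.not_disjoint_iff_nonempty_inter.1 hb.2)
  omega

variable (hp : 1 ≤ p)
include hp

lemma inner_topLp_oneLp (hw : IsDegenerateFamily ν p w) : inner ℝ hw.topLp (oneLp ι ν) = 0 := by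
  rw [topLp, sum_inner]
  refine Finset.sum_eq_zero fun a ha => ?_
  simp only [disjointPairs, Finset.mem_filter, Finset.mem_univ, true_and] at ha
  obtain ⟨i, hi⟩ := Finset.card_pos.1 (by omega : 0 < a.1.card)
  exact inner_eq_zero_of_avgOp (hw.avgOp_pairLp_of_disjoint ha.2 (Finset.mem_union_left _ hi))
    (avgOp_oneLp _)

lemma inner_topLp_midLp (hw : IsDegenerateFamily ν p w) : inner ℝ hw.topLp hw.midLp = 0 := by
  rw [midLp, inner_sub_right, hw.inner_topLp_oneLp hp, topLp, sum_inner, sub_zero]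
  refine Finset.sum_eq_zero fun a ha => ?_
  rw [inner_sum]
  exact Finset.sum_eq_zero fun b hb => hw.inner_pairLp_meeting ha hb

omit hp in
lemma gen_topLp (hw : IsDegenerateFamily ν p w) : gen ν hw.topLp = (2 * p : ℝ) • hw.topLp := by
  rw [topLp, gen_sum, Finset.smul_sum]
  refine Finset.sum_congr rfl fun a ha => ?_
  simp only [disjointPairs, Finset.mem_filter, Finset.mem_univ, true_and] at ha
  exact hw.gen_pairLp_of_disjoint ha.2

omit hp in
-- The crude degree bound `2p` suffices: it matches the normalisation `1 / (2p)` of the carré du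
-- champ, and this is what makes `norm_sub_sum_le` applicable.
lemma midLp_mem (hw : IsDegenerateFamily ν p w) :
    hw.midLp ∈ degreeLE (fun i : ι => avgOp ν {i}) Finset.univ (2 * p) := by
  refine Submodule.sub_mem _ (Submodule.sum_mem _ fun a ha => ?_) ?_
  · simp only [meetingPairs, Finset.mem_filter, Finset.mem_univ, true_and] at ha
    refine Submodule.subset_span ⟨a.1 ∪ a.2, ?_, fun i _ hi => ?_⟩
    · have := Finset.card_union_le a.1 a.2
      omega
    · rw [Finset.mem_union, not_or] at hi
      exact hw.avgOp_pairLp_of_notMem hi.1 hi.2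
  · exact Submodule.subset_span ⟨∅, by simp, fun i _ _ => avgOp_oneLp _⟩

lemma inner_midLp_oneLp (hw : IsDegenerateFamily ν p w)
    (hvar : ∫ x, kernelSum w x ^ 2 ∂(iidLaw ι ν) = 1) : inner ℝ hw.midLp (oneLp ι ν) = 0 := by
  have h : inner ℝ hw.sqLp (oneLp ι ν) = 1 := by
    rw [sqLp, oneLp, inner_toLp_toLp]
    refine Eq.trans (integral_congr_ae (Filter.Eventually.of_forall fun x => ?_)) hvar
    simp only
    ring
  rw [hw.sqLp_eq, inner_add_left, inner_add_left, real_inner_self_eq_norm_sq, norm_oneLp,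
    hw.inner_topLp_oneLp hp] at h
  linarith

/-- Pythagoras for the decomposition of the squared kernel sum. -/
lemma norm_sqLp_sq (hw : IsDegenerateFamily ν p w)
    (hvar : ∫ x, kernelSum w x ^ 2 ∂(iidLaw ι ν) = 1) :
    ‖hw.sqLp‖ ^ 2 = 1 + ‖hw.topLp‖ ^ 2 + ‖hw.midLp‖ ^ 2 := by
  have h1 := hw.inner_topLp_oneLp hp
  have h2 := hw.inner_topLp_midLp hp
  have h3 := hw.inner_midLp_oneLp hp hvar
  rw [← real_inner_self_eq_norm_sq, hw.sqLp_eq]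
  simp only [inner_add_left, inner_add_right]
  rw [real_inner_comm hw.topLp (oneLp ι ν), real_inner_comm hw.midLp (oneLp ι ν),
    real_inner_comm hw.topLp hw.midLp, h1, h2, h3]
  simp only [real_inner_self_eq_norm_sq, norm_oneLp]
  ring

/-- The generator kills constants, multiplies the top part by `2p` and is nonnegative on the rest;
self-adjointness removes the cross terms. -/
lemma le_inner_gen_sqLp (hw : IsDegenerateFamily ν p w) :
    2 * p * ‖hw.topLp‖ ^ 2 ≤ inner ℝ hw.sqLp (gen ν hw.sqLp) := by
  have h1 := hw.inner_topLp_oneLp hp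
  have h2 := hw.inner_topLp_midLp hp
  have h4 : inner ℝ (oneLp ι ν) (gen ν hw.midLp) = 0 := by
    rw [← inner_gen_symm, gen_oneLp, inner_zero_left]
  have h5 : inner ℝ hw.topLp (gen ν hw.midLp) = 0 := by
    rw [← inner_gen_symm, gen_topLp, inner_smul_left, h2, mul_zero]
  have h6 := inner_gen_nonneg hw.midLp
  rw [hw.sqLp_eq, gen_add, gen_add, gen_oneLp, zero_add, gen_topLp]
  simp only [inner_add_left, inner_add_right, inner_smul_right]
  rw [real_inner_comm hw.topLp (oneLp ι ν), real_inner_comm hw.topLp hw.midLp, h1, h2, h4, h5,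
    real_inner_self_eq_norm_sq]
  linarith

/-- The carré du champ of the kernel sum is close to its mean `2 p`. -/
lemma abs_integral_sub_le (hw : IsDegenerateFamily ν p w) {φ : (ι → E) → ℝ}
    (hφ : MemLp φ 2 (iidLaw ι ν)) (hφ1 : ∀ x, |φ x| ≤ 1) :
    |∫ x, φ x ∂(iidLaw ι ν) - (2 * p : ℝ)⁻¹ *
      ∑ i, ∫ q, φ q.1 * increment w i q ^ 2 ∂((iidLaw ι ν).prod (iidLaw ι ν))| ≤ ‖hw.midLp‖ := by
  have hp' : (0 : ℝ) < p := by exact_mod_cast hp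
  rw [hw.sum_integral_mul_increment_sq hφ]
  have e0 : ∫ x, φ x ∂(iidLaw ι ν) = inner ℝ (hφ.toLp φ) (oneLp ι ν) := by
    rw [oneLp, inner_toLp_toLp]; simp
  -- The constant cancels by normalisation and the top part by its eigenvalue `2p`; only the middle
  -- part survives.
  have e1 : ∫ x, φ x ∂(iidLaw ι ν) - (2 * p : ℝ)⁻¹ *
      (2 * p * inner ℝ (hφ.toLp φ) hw.sqLp - inner ℝ (hφ.toLp φ) (gen ν hw.sqLp)) =
      - inner ℝ (hφ.toLp φ) (hw.midLp - ((2 * p : ℕ) : ℝ)⁻¹ • gen ν hw.midLp) := by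
    rw [e0, hw.sqLp_eq, gen_add, gen_add, gen_oneLp, zero_add, gen_topLp]
    simp only [inner_add_right, inner_sub_right, inner_smul_right]
    push_cast
    field_simp
    ring
  rw [e1, abs_neg]
  refine (abs_real_inner_le_norm _ _).trans ?_
  have h1 : ‖hφ.toLp φ‖ ≤ 1 := by
    refine le_of_sq_le_sq ?_ zero_le_one
    rw [norm_toLp_sq, one_pow]
    calc ∫ x, φ x ^ 2 ∂(iidLaw ι ν) ≤ ∫ _, (1 : ℝ) ∂(iidLaw ι ν) := by
          refine integral_mono hφ.integrable_sq (integrable_const _) fun x => ?_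
          exact (sq_le_one_iff_abs_le_one _).2 (hφ1 x)
      _ = 1 := by simp
  have h2 := isProjectionFamily_avgOp.norm_sub_sum_le (by omega : 0 < 2 * p) hw.midLp_mem
  change ‖hw.midLp - ((2 * p : ℕ) : ℝ)⁻¹ • gen ν hw.midLp‖ ≤ ‖hw.midLp‖ at h2
  calc _ ≤ 1 * ‖hw.midLp‖ := mul_le_mul h1 h2 (norm_nonneg _) zero_le_one
    _ = _ := one_mul _

end IsDegenerateFamily

end Decomposition

/-! ### Lower bound on the top-degree part, and what the fourth moment controls. -/

section TopDegree

lemma map_eq_of_exchange {ι : Type*} {B C J J' : Finset ι}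
    {σ : Equiv.Perm ι} (hσ : ∀ i, σ (σ i) = i) (hσB : ∀ i ∈ B, σ i ∈ C) (hσC : ∀ i ∈ C, σ i ∈ B)
    (hσN : ∀ i, i ∉ B → i ∉ C → σ i = i) (hB : ∀ i ∈ B, i ∈ J ∧ i ∉ J')
    (hC : ∀ i ∈ C, i ∉ J ∧ i ∈ J') (hN : ∀ i, i ∉ B → i ∉ C → (i ∈ J ↔ i ∈ J')) :
    J.map σ.toEmbedding = J' := by
  ext i
  rw [Finset.mem_map_equiv, show σ.symm i = σ i by rw [Equiv.symm_apply_eq, hσ]]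
  by_cases h1 : i ∈ B
  · exact iff_of_false (hC _ (hσB i h1)).1 (hB i h1).2
  by_cases h2 : i ∈ C
  · exact iff_of_true (hB _ (hσC i h2)).1 (hC i h2).2
  · rw [hσN i h1 h2]; exact hN i h1 h2

variable {ι E : Type*} [DecidableEq ι] [MeasurableSpace E] [Fintype ι]

namespace IsDegenerateFamily

variable {ν : Measure E} [IsProbabilityMeasure ν] {p : ℕ} {w : Finset ι → (ι → E) → ℝ}

/-- By symmetry, all mixed moments of disjoint pairs of kernels are nonnegative. -/
lemma inner_pairLp_nonneg (hw : IsDegenerateFamily ν p w) {J K J' K' : Finset ι}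
    (hJ : J.card = p) (hJ' : J'.card = p)
    (hd : Disjoint J K) (hd' : Disjoint J' K') :
    0 ≤ inner ℝ (hw.pairLp J K) (hw.pairLp J' K') := by
  by_cases h1 : J ∪ K ⊆ J' ∪ K'
  swap
  · exact (hw.inner_pairLp_eq_zero hd h1).ge
  by_cases h2 : J' ∪ K' ⊆ J ∪ K
  swap
  · rw [real_inner_comm]; exact (hw.inner_pairLp_eq_zero hd' h2).ge
  have m1 : ∀ i, i ∈ J ∨ i ∈ K ↔ i ∈ J' ∨ i ∈ K' := fun i => by
    rw [← Finset.mem_union, ← Finset.mem_union]; exact ⟨fun h => h1 h, fun h => h2 h⟩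
  have m2 : ∀ i, i ∈ J → i ∉ K := fun _ h => Finset.disjoint_left.1 hd h
  have m3 : ∀ i, i ∈ J' → i ∉ K' := fun _ h => Finset.disjoint_left.1 hd' h
  -- When both pairs cover the same indices, `J ∩ K' = J \ J'` and `K ∩ J' = J' \ J`. These have
  -- equal size, and an involution swapping them carries `J` to `J'` and `K'` to `K`.
  have hBC : Disjoint (J ∩ K') (K ∩ J') := by
    rw [Finset.disjoint_left]
    intro i hi hi'
    simp only [Finset.mem_inter] at hi hi'
    exact m2 i hi.1 hi'.1
  have hcard : (J ∩ K').card = (K ∩ J').card := by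
    have e1 : J \ J' = J ∩ K' := by
      ext i; simp only [Finset.mem_sdiff, Finset.mem_inter]
      have := m1 i; have := m2 i; have := m3 i; tauto
    have e2 : J' \ J = K ∩ J' := by
      ext i; simp only [Finset.mem_sdiff, Finset.mem_inter]
      have := m1 i; have := m2 i; have := m3 i; tauto
    rw [← e1, ← e2]
    exact Finset.card_sdiff_comm (hJ.trans hJ'.symm)
  obtain ⟨σ, hσ, hσB, hσC, hσN⟩ := exists_involutive_perm hBC hcard
  have hJmap : J.map σ.toEmbedding = J' := by
    refine map_eq_of_exchange hσ hσB hσC hσN (fun i hi => ?_) (fun i hi => ?_) fun i hB hC => ?_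
    · rw [Finset.mem_inter] at hi; exact ⟨hi.1, fun h => m3 i h hi.2⟩
    · rw [Finset.mem_inter] at hi; exact ⟨fun h => m2 i h hi.1, hi.2⟩
    · rw [Finset.mem_inter] at hB hC
      have := m1 i; tauto
  have hKmap : K'.map σ.toEmbedding = K := by
    refine map_eq_of_exchange hσ hσB hσC hσN (fun i hi => ?_) (fun i hi => ?_) fun i hB hC => ?_
    · rw [Finset.mem_inter] at hi; exact ⟨hi.2, m2 i hi.1⟩
    · rw [Finset.mem_inter] at hi; exact ⟨m3 i hi.2, hi.1⟩
    · rw [Finset.mem_inter] at hB hC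
      have := m1 i; tauto
  have hJ2 : ∀ y, w J' y = w J (y ∘ σ) := fun y => by rw [hw.perm, hJmap]
  have hK2 : ∀ y, w K y = w K' (y ∘ σ) := fun y => by rw [hw.perm, hKmap]
  have hθ : MeasurePreserving (fun q : (ι → E) × (ι → E) => resample (K ∩ J') q.1 (q.2 ∘ σ))
      ((iidLaw ι ν).prod (iidLaw ι ν)) (iidLaw ι ν) :=
    (measurePreserving_resample (K ∩ J')).comp
      ((MeasurePreserving.id _).prod (measurePreserving_perm σ))
  -- Draw the coordinates in `K ∩ J'` from the relabelled independent copy. Then `w J' * w K`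
  -- becomes `w J * w K'` with the coordinates in `J ∩ K'` resampled, so the mixed moment is `⟨F, P
  -- F⟩` for an orthogonal projection `P`.
  have key : inner ℝ (hw.pairLp J K) (hw.pairLp J' K') =
      inner ℝ (hw.pairLp J K') (avgOp ν (J ∩ K') (hw.pairLp J K')) := by
    rw [pairLp, pairLp, pairLp, inner_toLp_toLp, inner_avgOp, ← hθ.integral_comp_ae]
    · refine integral_congr_ae (Filter.Eventually.of_forall fun q => ?_)
      have a1 : Disjoint (K ∩ J') J := hd.symm.mono_left Finset.inter_subset_left
      have a2 : Disjoint (K ∩ J') K' := hd'.mono_left Finset.inter_subset_right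
      have b : ∀ i, (i ∈ J ∨ i ∈ K') →
          (resample (K ∩ J') q.1 (q.2 ∘ σ) ∘ σ) i = resample (J ∩ K') q.1 q.2 i := fun i hi => by
        simp only [Function.comp, resample]
        by_cases hB : i ∈ J ∩ K'
        · rw [if_pos (hσB i hB), if_pos hB, hσ]
        · have hC : i ∉ K ∩ J' := by
            rcases hi with hi | hi
            · exact Finset.disjoint_right.1 a1 hi
            · exact Finset.disjoint_right.1 a2 hi
          rw [hσN i hB hC, if_neg hC, if_neg hB]
      have b1 : w J' (resample (K ∩ J') q.1 (q.2 ∘ σ)) = w J (resample (J ∩ K') q.1 q.2) := by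
        rw [hJ2]
        exact hw.eq_of_eqOn J _ _ fun i hi => b i (Or.inl hi)
      have b2 : w K (resample (K ∩ J') q.1 (q.2 ∘ σ)) = w K' (resample (J ∩ K') q.1 q.2) := by
        rw [hK2]
        exact hw.eq_of_eqOn K' _ _ fun i hi => b i (Or.inr hi)
      simp only
      rw [b1, b2, hw.resample_of_disjoint a1, hw.resample_of_disjoint a2]
      ring
    · exact (((hw.memLp J).mul_four (hw.memLp K)).integrable_mul_two
        ((hw.memLp J').mul_four (hw.memLp K'))).1
  rw [key, ← Finset.union_self (J ∩ K'), ← avgOp_avgOp, ← inner_avgOp_symm]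
  exact real_inner_self_nonneg

/-- The second moment of a kernel. -/
noncomputable def kernelVar (ν : Measure E) (w : Finset ι → (ι → E) → ℝ) (J : Finset ι) : ℝ :=
  ∫ x, w J x ^ 2 ∂(iidLaw ι ν)

omit [IsProbabilityMeasure ν] [DecidableEq ι] in
lemma kernelVar_nonneg (J : Finset ι) : 0 ≤ kernelVar ν w J :=
  integral_nonneg fun _ => sq_nonneg _

lemma kernelVar_map (hw : IsDegenerateFamily ν p w) (σ : Equiv.Perm ι) (J : Finset ι) :
    kernelVar ν w (J.map σ.toEmbedding) = kernelVar ν w J := by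
  simp only [kernelVar, ← hw.perm]
  exact (measurePreserving_perm σ).integral_comp_ae (g := fun x => w J x ^ 2)
    (hw.memLp J).of_four.integrable_sq.1

/-- Distinct index sets of the same size differ by an index in `J` but not in `K`; averaging over it
kills `w J` and leaves `w K` alone. -/
lemma integral_mul_eq_zero (hw : IsDegenerateFamily ν p w) {J K : Finset ι} (h : J ≠ K) :
    ∫ x, w J x * w K x ∂(iidLaw ι ν) = 0 := by
  by_cases hJ : J.card = p
  swap
  · simp [hw.eq_zero J hJ]
  by_cases hK : K.card = p
  swap
  · simp [hw.eq_zero K hK]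
  obtain ⟨i, hi, hi'⟩ := Finset.not_subset.1 fun hs : J ⊆ K =>
    h (Finset.eq_of_subset_of_card_le hs (by omega))
  have h1 := hw.integral_mul_resample_eq_zero (hw.memLp K).of_four (memLp_const 1) hi
  rw [← h1, ← (measurePreserving_resample (ν := ν) {i}).integral_comp_ae
    ((hw.memLp J).of_four.integrable_mul_two (hw.memLp K).of_four).1]
  refine integral_congr_ae (Filter.Eventually.of_forall fun q => ?_)
  simp only
  rw [hw.resample_of_disjoint (Finset.disjoint_singleton_left.2 hi')]
  ring

lemma sum_kernelVar (hw : IsDegenerateFamily ν p w) :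
    ∑ J, kernelVar ν w J = ∫ x, kernelSum w x ^ 2 ∂(iidLaw ι ν) := by
  have e : ∀ x, kernelSum w x ^ 2 = ∑ J, ∑ K, w J x * w K x := fun x => by
    rw [sq, kernelSum, Finset.sum_mul_sum]
  simp_rw [e]
  have hi : ∀ J K, Integrable (fun x => w J x * w K x) (iidLaw ι ν) := fun J K =>
    (hw.memLp J).of_four.integrable_mul_two (hw.memLp K).of_four
  rw [integral_finsetSum _ fun J _ => integrable_finsetSum _ fun K _ => hi J K]
  refine Finset.sum_congr rfl fun J _ => ?_
  rw [integral_finsetSum _ fun K _ => hi J K, Finset.sum_eq_single J]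
  · simp only [kernelVar, sq]
  · exact fun K _ hK => hw.integral_mul_eq_zero hK.symm
  · simp

lemma norm_pairLp_sq (hw : IsDegenerateFamily ν p w) {J K : Finset ι} (hd : Disjoint J K) :
    ‖hw.pairLp J K‖ ^ 2 = kernelVar ν w J * kernelVar ν w K := by
  have hm := (hw.memLp J).mul_four (hw.memLp K)
  rw [pairLp, norm_toLp_sq, kernelVar, kernelVar, ← integral_prod_mul,
    ← (measurePreserving_resample (ν := ν) K).integral_comp_ae hm.integrable_sq.1]
  refine integral_congr_ae (Filter.Eventually.of_forall fun q => ?_)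
  simp only
  rw [hw.resample_of_disjoint hd.symm, hw.eq_of_eqOn K (resample K q.1 q.2) q.2 fun i hi => by
    simp [resample, hi]]
  ring

/-- The second moments of the kernels that involve a given coordinate. -/
lemma sum_kernelVar_mem (hw : IsDegenerateFamily ν p w)
    (hvar : ∫ x, kernelSum w x ^ 2 ∂(iidLaw ι ν) = 1) (i : ι) :
    ∑ J, (if i ∈ J then kernelVar ν w J else 0) = p / Fintype.card ι := by
  set t : ι → ℝ := fun i => ∑ J, (if i ∈ J then kernelVar ν w J else 0) with ht
  -- Transposing `i` and `k` preserves the second moments, so the total `p` is shared equally among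
  -- all coordinates.
  have h1 : ∀ k, t k = t i := fun k => by
    simp only [ht]
    refine Fintype.sum_equiv (Equiv.finsetCongr (Equiv.swap i k)) _ _ fun J => ?_
    simp only [Equiv.finsetCongr_apply, hw.kernelVar_map, Finset.mem_map_equiv, Equiv.symm_swap,
      Equiv.swap_apply_left]
  have h2 : ∑ k, t k = p := by
    simp only [ht]
    rw [Finset.sum_comm]
    have : ∀ J : Finset ι, (∑ k, if k ∈ J then kernelVar ν w J else 0) = p * kernelVar ν w J :=
      fun J => by
        rw [Finset.sum_ite_mem, Finset.univ_inter, Finset.sum_const, nsmul_eq_mul]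
        by_cases h : J.card = p
        · rw [h]
        · simp [kernelVar, hw.eq_zero J h]
    rw [Finset.sum_congr rfl fun J _ => this J, ← Finset.mul_sum, hw.sum_kernelVar, hvar, mul_one]
  rw [Finset.sum_congr rfl fun k _ => h1 k, Finset.sum_const, nsmul_eq_mul, Finset.card_univ] at h2
  have : Nonempty ι := ⟨i⟩
  have hn : (Fintype.card ι : ℝ) ≠ 0 := by exact_mod_cast Fintype.card_ne_zero
  rw [eq_div_iff hn, mul_comm]
  exact h2

/-- Over all pairs the sum is `(∑ kernelVar)² = 1`. Intersecting pairs are removed by a union bound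
over a common index, costing `n (p/n)² = p²/n` for `n` coordinates. -/
lemma le_sum_disjointPairs (hw : IsDegenerateFamily ν p w)
    (hvar : ∫ x, kernelSum w x ^ 2 ∂(iidLaw ι ν) = 1) [Nonempty ι] :
    1 - (p : ℝ) ^ 2 / Fintype.card ι ≤
      ∑ a ∈ disjointPairs ι p, kernelVar ν w a.1 * kernelVar ν w a.2 := by
  have h0 : ∀ J, J.card ≠ p → kernelVar ν w J = 0 := fun J h => by
    simp [kernelVar, hw.eq_zero J h]
  have h1 : ∀ a : Finset ι × Finset ι, kernelVar ν w a.1 * kernelVar ν w a.2 ≤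
      (if a ∈ disjointPairs ι p then kernelVar ν w a.1 * kernelVar ν w a.2 else 0) +
      ∑ i, (if i ∈ a.1 then kernelVar ν w a.1 else 0) *
        (if i ∈ a.2 then kernelVar ν w a.2 else 0) := fun a => by
    have hn1 := kernelVar_nonneg (ν := ν) (w := w) a.1
    have hn2 := kernelVar_nonneg (ν := ν) (w := w) a.2
    have hs : ∀ i ∈ Finset.univ, 0 ≤ (if i ∈ a.1 then kernelVar ν w a.1 else 0) *
        (if i ∈ a.2 then kernelVar ν w a.2 else 0) := fun i _ => by
      split_ifs <;> simp [*, mul_nonneg]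
    by_cases hp : a.1.card = p ∧ a.2.card = p
    swap
    · have : kernelVar ν w a.1 * kernelVar ν w a.2 = 0 := by
        rcases not_and_or.1 hp with h | h
        · rw [h0 _ h, zero_mul]
        · rw [h0 _ h, mul_zero]
      rw [this, ite_self, zero_add]
      exact Finset.sum_nonneg hs
    by_cases hd : Disjoint a.1 a.2
    · rw [if_pos (by simp [disjointPairs, hp, hd])]
      linarith [Finset.sum_nonneg hs]
    · obtain ⟨i, hi, hi'⟩ := Finset.not_disjoint_iff.1 hd
      have := Finset.single_le_sum hs (Finset.mem_univ i)
      rw [if_pos hi, if_pos hi'] at this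
      have h3 : (0 : ℝ) ≤ if a ∈ disjointPairs ι p then kernelVar ν w a.1 * kernelVar ν w a.2
          else 0 := by
        split_ifs
        · positivity
        · exact le_rfl
      linarith
  have h2 := Finset.sum_le_sum fun a (_ : a ∈ Finset.univ) => h1 a
  rw [Finset.sum_add_distrib, Finset.sum_ite_mem, Finset.univ_inter, Finset.sum_comm,
    Fintype.sum_prod_type] at h2
  simp_rw [Fintype.sum_prod_type] at h2
  simp_rw [← Finset.sum_mul_sum] at h2
  rw [hw.sum_kernelVar, hvar] at h2
  simp_rw [hw.sum_kernelVar_mem hvar] at h2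
  rw [Finset.sum_const, nsmul_eq_mul, Finset.card_univ] at h2
  have hn : (Fintype.card ι : ℝ) ≠ 0 := by exact_mod_cast Fintype.card_ne_zero
  have e : (Fintype.card ι : ℝ) * (p / Fintype.card ι * (p / Fintype.card ι)) =
      (p : ℝ) ^ 2 / Fintype.card ι := by field_simp
  rw [e] at h2
  linarith

/-- In the expanded square all mixed moments are nonnegative, so only the pairings of `(J, K)` with
itself and with `(K, J)` need be kept. They are equal, and this factor `2` accounts for the Gaussian
value `3 = 1 + 2`. -/
lemma le_norm_topLp_sq (hw : IsDegenerateFamily ν p w) (hp : 1 ≤ p)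
    (hvar : ∫ x, kernelSum w x ^ 2 ∂(iidLaw ι ν) = 1) [Nonempty ι] :
    2 * (1 - (p : ℝ) ^ 2 / Fintype.card ι) ≤ ‖hw.topLp‖ ^ 2 := by
  refine (mul_le_mul_of_nonneg_left (hw.le_sum_disjointPairs hvar) zero_le_two).trans ?_
  rw [← real_inner_self_eq_norm_sq, topLp, sum_inner, Finset.mul_sum]
  refine Finset.sum_le_sum fun a ha => ?_
  rw [inner_sum]
  have ha' := ha
  simp only [disjointPairs, Finset.mem_filter, Finset.mem_univ, true_and] at ha'
  -- Here `1 ≤ p` matters: for empty index sets the two pairings would coincide.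
  have hne : a ≠ a.swap := fun h => by
    have h1 : a.1 = a.2 := congrArg Prod.fst h
    obtain ⟨i, hi⟩ := Finset.card_pos.1 (by omega : 0 < a.1.card)
    exact Finset.disjoint_left.1 ha'.2 hi (h1 ▸ hi)
  have hmem : ({a, a.swap} : Finset (Finset ι × Finset ι)) ⊆ disjointPairs ι p := by
    intro b hb
    rw [Finset.mem_insert, Finset.mem_singleton] at hb
    rcases hb with rfl | rfl
    · exact ha
    · simp [disjointPairs, ha'.1.1, ha'.1.2, ha'.2.symm]
  refine le_trans ?_ (Finset.sum_le_sum_of_subset_of_nonneg hmem fun b hb _ => ?_)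
  · rw [Finset.sum_pair hne, Prod.fst_swap, Prod.snd_swap, hw.pairLp_comm a.2 a.1,
      real_inner_self_eq_norm_sq, hw.norm_pairLp_sq ha'.2]
    linarith
  · simp only [disjointPairs, Finset.mem_filter, Finset.mem_univ, true_and] at hb
    exact hw.inner_pairLp_nonneg ha'.1.1 hb.1.1 ha'.2 hb.2

/-- The fourth moment controls the part of the squared kernel sum of degree less than `2 p`. -/
lemma norm_midLp_sq_le (hw : IsDegenerateFamily ν p w) (hp : 1 ≤ p)
    (hvar : ∫ x, kernelSum w x ^ 2 ∂(iidLaw ι ν) = 1) [Nonempty ι] :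
    ‖hw.midLp‖ ^ 2 ≤ |‖hw.sqLp‖ ^ 2 - 3| + 2 * ((p : ℝ) ^ 2 / Fintype.card ι) := by
  have h1 := hw.norm_sqLp_sq hp hvar
  have h2 := hw.le_norm_topLp_sq hp hvar
  have h3 := le_abs_self (‖hw.sqLp‖ ^ 2 - 3)
  linarith

/-- The fourth moment controls the fourth moments of the increments. -/
lemma incrementFourth_le (hw : IsDegenerateFamily ν p w) (hp : 1 ≤ p)
    (hvar : ∫ x, kernelSum w x ^ 2 ∂(iidLaw ι ν) = 1) [Nonempty ι] :
    incrementFourth ν w ≤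
      p * (8 * |‖hw.sqLp‖ ^ 2 - 3| + 24 * ((p : ℝ) ^ 2 / Fintype.card ι)) := by
  have h1 := hw.fourth_moment_identity
  have h2 := hw.le_inner_gen_sqLp hp
  have h3 := hw.le_norm_topLp_sq hp hvar
  have h4 := le_abs_self (‖hw.sqLp‖ ^ 2 - 3)
  have hp' : (0 : ℝ) ≤ p := Nat.cast_nonneg p
  -- The fourth moment identity solved for the increments; at the Gaussian values `3` and `2` the
  -- right-hand side vanishes.
  have h5 : incrementFourth ν w ≤ p * (8 * ‖hw.sqLp‖ ^ 2 - 12 * ‖hw.topLp‖ ^ 2) := by linarith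
  refine h5.trans (mul_le_mul_of_nonneg_left ?_ hp')
  linarith

end IsDegenerateFamily

end TopDegree

/-! ### Antisymmetric squares of increments and their conditional expectations. -/

section SignedSquare

/-- For equal signs this is `(a + b)² ≤ 4 (a² + ab + b²)`; for opposite signs `a² + b²` is bounded
once by `(a - b)²` and once by `2 (a² + ab + b²)`. The right-hand side is linear in one increment,
so an eigenvector identity can evaluate it. -/
lemma signed_sq_sub_sq_le (a b : ℝ) :
    (a * |a| - b * |b|) ^ 2 ≤ 4 * ((a ^ 3 - b ^ 3) * (a - b)) := by
  have e : (a ^ 3 - b ^ 3) * (a - b) = (a - b) ^ 2 * (a ^ 2 + a * b + b ^ 2) := by ring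
  rw [e]
  have hs := sq_nonneg (a - b)
  rcases le_total 0 a with ha | ha <;> rcases le_total 0 b with hb | hb
  · rw [abs_of_nonneg ha, abs_of_nonneg hb]
    have : (a * a - b * b) ^ 2 = (a - b) ^ 2 * (a + b) ^ 2 := by ring
    rw [this]
    nlinarith [mul_nonneg hs (sq_nonneg (a - b)), mul_nonneg hs (sq_nonneg a),
      mul_nonneg hs (sq_nonneg b), mul_nonneg hs (sq_nonneg (a + b))]
  · rw [abs_of_nonneg ha, abs_of_nonpos hb]
    have hab : a * b ≤ 0 := mul_nonpos_of_nonneg_of_nonpos ha hb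
    have h1 : a ^ 2 + b ^ 2 ≤ (a - b) ^ 2 := by nlinarith
    have h2 : a ^ 2 + b ^ 2 ≤ 2 * (a ^ 2 + a * b + b ^ 2) := by nlinarith [sq_nonneg (a + b)]
    have h3 := mul_le_mul h1 h2 (by positivity) hs
    have h4 : (a * a - b * -b) ^ 2 = (a ^ 2 + b ^ 2) * (a ^ 2 + b ^ 2) := by ring
    rw [h4]
    have : 0 ≤ (a ^ 2 + b ^ 2) * (a ^ 2 + b ^ 2) := by positivity
    linarith
  · rw [abs_of_nonpos ha, abs_of_nonneg hb]
    have hab : a * b ≤ 0 := mul_nonpos_of_nonpos_of_nonneg ha hb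
    have h1 : a ^ 2 + b ^ 2 ≤ (a - b) ^ 2 := by nlinarith
    have h2 : a ^ 2 + b ^ 2 ≤ 2 * (a ^ 2 + a * b + b ^ 2) := by nlinarith [sq_nonneg (a + b)]
    have h3 := mul_le_mul h1 h2 (by positivity) hs
    have h4 : (a * -a - b * b) ^ 2 = (a ^ 2 + b ^ 2) * (a ^ 2 + b ^ 2) := by ring
    rw [h4]
    have : 0 ≤ (a ^ 2 + b ^ 2) * (a ^ 2 + b ^ 2) := by positivity
    linarith
  · rw [abs_of_nonpos ha, abs_of_nonpos hb]
    have : (a * -a - b * -b) ^ 2 = (a - b) ^ 2 * (a + b) ^ 2 := by ring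
    rw [this]
    nlinarith [mul_nonneg hs (sq_nonneg (a - b)), mul_nonneg hs (sq_nonneg a),
      mul_nonneg hs (sq_nonneg b), mul_nonneg hs (sq_nonneg (a + b))]

variable {ι E : Type*} [DecidableEq ι] [MeasurableSpace E] [Fintype ι]

section Conditional

variable {ν : Measure E} [IsProbabilityMeasure ν]

omit [DecidableEq ι] in
lemma integral_sq_integral_le {α β : Type*} [MeasurableSpace α] [MeasurableSpace β] {μ : Measure α}
    {ρ : Measure β} [IsProbabilityMeasure μ] [IsProbabilityMeasure ρ] {F : α × β → ℝ}
    (hF : MemLp F 2 (μ.prod ρ)) :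
    ∫ x, (∫ y, F (x, y) ∂ρ) ^ 2 ∂μ ≤ ∫ q, F q ^ 2 ∂(μ.prod ρ) := by
  have hi := hF.integrable_sq
  rw [integral_prod _ hi]
  refine integral_mono_ae hF.integral_prod_right_two.integrable_sq hi.integral_prod_left ?_
  filter_upwards [hi.prod_right_ae, hF.1.prodMk_left] with x hx hx'
  exact sq_integral_le_integral_sq ((memLp_two_iff_integrable_sq hx').2 hx)

/-- The conditional expectation given the first component, as an element of `L²`. -/
noncomputable def condLp {G : (ι → E) × (ι → E) → ℝ}
    (hG : MemLp G 2 ((iidLaw ι ν).prod (iidLaw ι ν))) : Lp ℝ 2 (iidLaw ι ν) :=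
  hG.integral_prod_right_two.toLp _

omit [DecidableEq ι] in
lemma inner_condLp {G : (ι → E) × (ι → E) → ℝ} (hG : MemLp G 2 ((iidLaw ι ν).prod (iidLaw ι ν)))
    {u : (ι → E) → ℝ} (hu : MemLp u 2 (iidLaw ι ν)) :
    inner ℝ (hu.toLp u) (condLp hG) = ∫ q, u q.1 * G q ∂((iidLaw ι ν).prod (iidLaw ι ν)) := by
  rw [condLp, inner_toLp_toLp, integral_prod]
  · simp only [integral_const_mul]
  · exact hu.comp_fst_prod.integrable_mul_two hG

omit [DecidableEq ι] in
lemma norm_condLp_sq_le {G : (ι → E) × (ι → E) → ℝ}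
    (hG : MemLp G 2 ((iidLaw ι ν).prod (iidLaw ι ν))) :
    ‖condLp hG‖ ^ 2 ≤ ∫ q, G q ^ 2 ∂((iidLaw ι ν).prod (iidLaw ι ν)) := by
  rw [condLp, norm_toLp_sq]
  exact integral_sq_integral_le hG

/-- Paired with any function not depending on the coordinates in `A`, the integral changes sign
under the exchange, hence is zero. -/
lemma avgOp_condLp_eq_zero {G : (ι → E) × (ι → E) → ℝ}
    (hG : MemLp G 2 ((iidLaw ι ν).prod (iidLaw ι ν))) {A : Finset ι}
    (h : ∀ q : (ι → E) × (ι → E), G (resample A q.1 q.2, resample A q.2 q.1) = - G q) :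
    avgOp ν A (condLp hG) = 0 := by
  have key : ∀ f : Lp ℝ 2 (iidLaw ι ν), inner ℝ f (avgOp ν A (condLp hG)) = 0 := fun f => by
    have hf := Lp.memLp f
    rw [← inner_avgOp_symm, ← Lp.toLp_coeFn f hf, avgOp_toLp, inner_condLp]
    have hi := ((memLp_avg hf A).comp_fst_prod (ρ := iidLaw ι ν)).integrable_mul_two hG
    have h1 := integral_exchange A hi.1
    have h2 : ∀ x y : ι → E, avg ν A f (resample A x y) = avg ν A f x := fun x y => by
      simp only [avg]
      congr 1
      funext z
      congr 1
      funext i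
      simp only [resample]
      split_ifs <;> rfl
    simp only [h, h2, mul_neg, integral_neg] at h1
    linarith
  exact inner_self_eq_zero.1 (key _)

/-- The left side is half the mean squared difference of an exchangeable pair; Jensen's inequality
then pulls the integral over the independent copy outside the square. -/
lemma norm_condLp_sub_avgOp_sq_le {G : (ι → E) × (ι → E) → ℝ}
    (hG : MemLp G 2 ((iidLaw ι ν).prod (iidLaw ι ν))) (A : Finset ι) :
    ‖condLp hG - avgOp ν A (condLp hG)‖ ^ 2 ≤
      1 / 2 * ∫ r, (G (r.1.1, r.2) - G (resample A r.1.1 r.1.2, r.2)) ^ 2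
        ∂(((iidLaw ι ν).prod (iidLaw ι ν)).prod (iidLaw ι ν)) := by
  set H : (ι → E) → ℝ := fun x => ∫ y, G (x, y) ∂(iidLaw ι ν) with hHdef
  have hH : MemLp H 2 (iidLaw ι ν) := hG.integral_prod_right_two
  have e1 : ‖condLp hG - avgOp ν A (condLp hG)‖ ^ 2 =
      inner ℝ (condLp hG) (condLp hG - avgOp ν A (condLp hG)) := by
    rw [← real_inner_self_eq_norm_sq, inner_sub_left, inner_avgOp_symm, map_sub, avgOp_avgOp,
      Finset.union_self, sub_self, inner_zero_right, sub_zero]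
  have hf := hH.comp_fst_prod (ρ := iidLaw ι ν)
  have hr := hH.resample A
  have i1 := hf.integrable_mul_two hf
  have i2 := hf.integrable_mul_two hr
  have i3 := hr.integrable_mul_two hr
  have e2 : inner ℝ (condLp hG) (condLp hG - avgOp ν A (condLp hG)) =
      1 / 2 * ∫ q, (H q.1 - H (resample A q.1 q.2)) ^ 2 ∂((iidLaw ι ν).prod (iidLaw ι ν)) := by
    have h1 : inner ℝ (condLp hG) (condLp hG) = ∫ q, H q.1 * H q.1
        ∂((iidLaw ι ν).prod (iidLaw ι ν)) := by
      rw [condLp, inner_toLp_toLp]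
      exact (measurePreserving_fst.integral_comp_ae (hH.integrable_mul_two hH).1).symm
    have h2 : ∫ q, H (resample A q.1 q.2) * H (resample A q.1 q.2)
        ∂((iidLaw ι ν).prod (iidLaw ι ν)) = ∫ q, H q.1 * H q.1
        ∂((iidLaw ι ν).prod (iidLaw ι ν)) := integral_exchange A i1.1
    have h3 : ∫ q, (H q.1 - H (resample A q.1 q.2)) ^ 2 ∂((iidLaw ι ν).prod (iidLaw ι ν)) =
        ∫ q, H q.1 * H q.1 ∂((iidLaw ι ν).prod (iidLaw ι ν)) -
        2 * (∫ q, H q.1 * H (resample A q.1 q.2) ∂((iidLaw ι ν).prod (iidLaw ι ν))) +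
        ∫ q, H (resample A q.1 q.2) * H (resample A q.1 q.2)
          ∂((iidLaw ι ν).prod (iidLaw ι ν)) := by
      have i12 := i1.sub (i2.const_mul 2)
      simp only [Pi.sub_def] at i12
      rw [← integral_const_mul, ← integral_sub i1 (i2.const_mul 2), ← integral_add i12 i3]
      congr 1; funext q; ring
    rw [inner_sub_right, h1, h3, h2, condLp, inner_avgOp]
    ring
  have hF1 : MemLp (fun r : ((ι → E) × (ι → E)) × (ι → E) => G (r.1.1, r.2)) 2
      (((iidLaw ι ν).prod (iidLaw ι ν)).prod (iidLaw ι ν)) :=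
    hG.comp_measurePreserving (measurePreserving_fst.prod (MeasurePreserving.id _))
  have hF2 : MemLp (fun r : ((ι → E) × (ι → E)) × (ι → E) => G (resample A r.1.1 r.1.2, r.2)) 2
      (((iidLaw ι ν).prod (iidLaw ι ν)).prod (iidLaw ι ν)) :=
    hG.comp_measurePreserving ((measurePreserving_resample A).prod (MeasurePreserving.id _))
  have h4 := integral_sq_integral_le (hF1.sub hF2)
  rw [e1, e2]
  refine mul_le_mul_of_nonneg_left (le_trans (le_of_eq ?_) h4) (by norm_num)
  refine integral_congr_ae ?_
  filter_upwards [(hF1.integrable one_le_two).prod_right_ae,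
    (hF2.integrable one_le_two).prod_right_ae] with q h5 h6
  simp only [Pi.sub_apply, hHdef]
  rw [integral_sub h5 h6]

end Conditional

namespace IsDegenerateFamily

variable {ν : Measure E} [IsProbabilityMeasure ν] {p : ℕ} {w : Finset ι → (ι → E) → ℝ}

/-- The signed square of the increment. -/
def signedSq (w : Finset ι → (ι → E) → ℝ) (i : ι) (q : (ι → E) × (ι → E)) : ℝ :=
  increment w i q * |increment w i q|

lemma memLp_signedSq (hw : IsDegenerateFamily ν p w) (i : ι) :
    MemLp (signedSq w i) 2 ((iidLaw ι ν).prod (iidLaw ι ν)) :=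
  (hw.memLp_increment i).mul_four (hw.memLp_increment i).abs

omit [IsProbabilityMeasure ν] in
lemma integral_signedSq_sq (w : Finset ι → (ι → E) → ℝ) (i : ι) :
    ∫ q, signedSq w i q ^ 2 ∂((iidLaw ι ν).prod (iidLaw ι ν)) =
      ∫ q, increment w i q ^ 4 ∂((iidLaw ι ν).prod (iidLaw ι ν)) := by
  congr 1
  funext q
  rw [signedSq, mul_pow, sq_abs]
  ring

lemma measurePreserving_swap_right {α β γ : Type*} [MeasurableSpace α] [MeasurableSpace β]
    [MeasurableSpace γ] (μ : Measure α) (ρ : Measure β) (τ : Measure γ) [SFinite μ] [SFinite ρ]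
    [SFinite τ] : MeasurePreserving (fun r : (α × β) × γ => ((r.1.1, r.2), r.1.2))
      ((μ.prod ρ).prod τ) ((μ.prod τ).prod ρ) := by
  have h1 := measurePreserving_prodAssoc μ ρ τ
  have h2 := (MeasurePreserving.id μ).prod (Measure.measurePreserving_swap (μ := ρ) (ν := τ))
  have h3 := (measurePreserving_prodAssoc μ τ ρ).symm
  exact (h3.comp h2).comp h1

/-- The resampled kernel averages out, conditionally on everything but the resampled coordinate. -/
lemma integral_mul_resample_comp_eq_zero (hw : IsDegenerateFamily ν p w)
    {a b : (ι → E) × (ι → E) → ℝ} (ha : MemLp a 2 ((iidLaw ι ν).prod (iidLaw ι ν)))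
    (hb : MemLp b 4 ((iidLaw ι ν).prod (iidLaw ι ν))) {T : (ι → E) × (ι → E) → ι → E}
    (hT : MeasurePreserving T ((iidLaw ι ν).prod (iidLaw ι ν)) (iidLaw ι ν))
    {J : Finset ι} {k : ι} (hk : k ∈ J) :
    Integrable (fun r : ((ι → E) × (ι → E)) × (ι → E) => a (r.1.1, r.2) * b (r.1.1, r.2) *
        w J (resample {k} (T (r.1.1, r.2)) r.1.2))
        (((iidLaw ι ν).prod (iidLaw ι ν)).prod (iidLaw ι ν)) ∧
      ∫ r, a (r.1.1, r.2) * b (r.1.1, r.2) * w J (resample {k} (T (r.1.1, r.2)) r.1.2)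
        ∂(((iidLaw ι ν).prod (iidLaw ι ν)).prod (iidLaw ι ν)) = 0 := by
  have hs := measurePreserving_swap_right (iidLaw ι ν) (iidLaw ι ν) (iidLaw ι ν)
  have hm : MeasurePreserving (fun r : ((ι → E) × (ι → E)) × (ι → E) => resample {k} (T r.1) r.2)
      (((iidLaw ι ν).prod (iidLaw ι ν)).prod (iidLaw ι ν)) (iidLaw ι ν) :=
    (measurePreserving_resample {k}).comp (hT.prod (MeasurePreserving.id _))
  have hi : Integrable (fun r : ((ι → E) × (ι → E)) × (ι → E) => a r.1 * b r.1 *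
      w J (resample {k} (T r.1) r.2))
      (((iidLaw ι ν).prod (iidLaw ι ν)).prod (iidLaw ι ν)) := by
    simp_rw [mul_assoc]
    exact (ha.comp_measurePreserving measurePreserving_fst).integrable_mul_two
      ((hb.comp_measurePreserving measurePreserving_fst).mul_four
        ((hw.memLp J).comp_measurePreserving hm))
  refine ⟨hs.integrable_comp_of_integrable hi, ?_⟩
  have h1 := hs.integral_comp_ae hi.1
  simp only at h1
  rw [h1, integral_prod _ hi]
  refine integral_eq_zero_of_ae ?_
  filter_upwards [hT.quasiMeasurePreserving.ae (hw.avg_eq_zero J k hk)] with q hq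
  simp only [integral_const_mul]
  simp only [avg] at hq
  rw [hq]
  simp

/-- Only kernels with `j ∈ J` contribute to the increment, and their differences remain degenerate
in the other `p - 1` coordinates. So the increment is an eigenvector with eigenvalue `p - 1` for
resampling those; the test function is its cube. -/
lemma sum_integral_increment_sub (hw : IsDegenerateFamily ν p w) (j : ι) :
    ∑ k ∈ Finset.univ.erase j, ∫ r, increment w j (r.1.1, r.2) * increment w j (r.1.1, r.2) *
        increment w j (r.1.1, r.2) * (increment w j (r.1.1, r.2) -
          increment w j (resample {k} r.1.1 r.1.2, r.2))
        ∂(((iidLaw ι ν).prod (iidLaw ι ν)).prod (iidLaw ι ν)) =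
      (p - 1) * ∫ q, increment w j q ^ 4 ∂((iidLaw ι ν).prod (iidLaw ι ν)) := by
  have hd := hw.memLp_increment j
  have ha := hd.mul_four hd
  set d : Finset ι → (ι → E) × (ι → E) → ℝ := fun J q => w J q.1 - w J (resample {j} q.1 q.2)
    with hddef
  have hsum : ∀ q, increment w j q = ∑ J, d J q := fun q => by
    simp only [increment, kernelSum, hddef, Finset.sum_sub_distrib]
  have hdJ : ∀ J, MemLp (d J) 4 ((iidLaw ι ν).prod (iidLaw ι ν)) := fun J =>
    (hw.memLp J).comp_fst_prod.sub ((hw.memLp J).resample _)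
  set c : (ι → E) × (ι → E) → ℝ := fun q => increment w j q * increment w j q * increment w j q
    with hc
  have i0 : ∀ J, Integrable (fun q => c q * d J q) ((iidLaw ι ν).prod (iidLaw ι ν)) := fun J => by
    simp only [hc, mul_assoc (_ * _)]
    exact ha.integrable_mul_two (hd.mul_four (hdJ J))
  have hm1 : MeasurePreserving (fun r : ((ι → E) × (ι → E)) × (ι → E) => (r.1.1, r.2))
      (((iidLaw ι ν).prod (iidLaw ι ν)).prod (iidLaw ι ν)) ((iidLaw ι ν).prod (iidLaw ι ν)) :=
    measurePreserving_fst.prod (MeasurePreserving.id _)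
  have hm2 : ∀ k, MeasurePreserving
      (fun r : ((ι → E) × (ι → E)) × (ι → E) => (resample {k} r.1.1 r.1.2, r.2))
      (((iidLaw ι ν).prod (iidLaw ι ν)).prod (iidLaw ι ν)) ((iidLaw ι ν).prod (iidLaw ι ν)) :=
    fun k => (measurePreserving_resample {k}).prod (MeasurePreserving.id _)
  have i1 : ∀ J, Integrable (fun r : ((ι → E) × (ι → E)) × (ι → E) => c (r.1.1, r.2) *
      d J (r.1.1, r.2)) (((iidLaw ι ν).prod (iidLaw ι ν)).prod (iidLaw ι ν)) := fun J =>
    hm1.integrable_comp_of_integrable (i0 J)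
  have i2 : ∀ J k, Integrable (fun r : ((ι → E) × (ι → E)) × (ι → E) => c (r.1.1, r.2) *
      d J (resample {k} r.1.1 r.1.2, r.2))
      (((iidLaw ι ν).prod (iidLaw ι ν)).prod (iidLaw ι ν)) := fun J k => by
    simp only [hc, mul_assoc (_ * _)]
    exact (ha.comp_measurePreserving hm1).integrable_mul_two
      ((hd.comp_measurePreserving hm1).mul_four ((hdJ J).comp_measurePreserving (hm2 k)))
  have key : ∀ J, ∀ k ∈ Finset.univ.erase j, ∫ r : ((ι → E) × (ι → E)) × (ι → E),
      (c (r.1.1, r.2) * d J (r.1.1, r.2) -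
        c (r.1.1, r.2) * d J (resample {k} r.1.1 r.1.2, r.2))
        ∂(((iidLaw ι ν).prod (iidLaw ι ν)).prod (iidLaw ι ν)) =
      if k ∈ J then ∫ q, c q * d J q ∂((iidLaw ι ν).prod (iidLaw ι ν)) else 0 := fun J k hk => by
    have hkj : k ≠ j := Finset.ne_of_mem_erase hk
    have hdisj : Disjoint ({k} : Finset ι) {j} := Finset.disjoint_singleton.2 hkj
    split_ifs with h
    · have z1 := hw.integral_mul_resample_comp_eq_zero ha hd
        (measurePreserving_fst (μ := iidLaw ι ν) (ν := iidLaw ι ν)) h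
      have z2 := hw.integral_mul_resample_comp_eq_zero ha hd (measurePreserving_resample {j}) h
      have z3 : ∫ r : ((ι → E) × (ι → E)) × (ι → E),
          c (r.1.1, r.2) * d J (resample {k} r.1.1 r.1.2, r.2)
          ∂(((iidLaw ι ν).prod (iidLaw ι ν)).prod (iidLaw ι ν)) = 0 := by
        have := integral_sub z1.1 z2.1
        rw [z1.2, z2.2, sub_zero] at this
        rw [← this]
        refine integral_congr_ae (Filter.Eventually.of_forall fun r => ?_)
        simp only [hc, hddef]
        rw [resample_comm hdisj]
        ring
      rw [integral_sub (i1 J) (i2 J k), z3, sub_zero]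
      exact hm1.integral_comp_ae (i0 J).1
    · have h' : Disjoint {k} J := Finset.disjoint_singleton_left.2 h
      simp only [hddef]
      simp only [resample_comm hdisj, hw.resample_of_disjoint h', sub_self, integral_zero]
  have e1 : ∀ k ∈ Finset.univ.erase j, ∫ r, increment w j (r.1.1, r.2) *
        increment w j (r.1.1, r.2) *
        increment w j (r.1.1, r.2) * (increment w j (r.1.1, r.2) -
          increment w j (resample {k} r.1.1 r.1.2, r.2))
        ∂(((iidLaw ι ν).prod (iidLaw ι ν)).prod (iidLaw ι ν)) =
      ∑ J, if k ∈ J then ∫ q, c q * d J q ∂((iidLaw ι ν).prod (iidLaw ι ν)) else 0 :=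
    fun k hk => by
    rw [← Finset.sum_congr rfl fun J _ => key J k hk, ← integral_finsetSum]
    · refine integral_congr_ae (Filter.Eventually.of_forall fun r => ?_)
      simp only [hc, Finset.sum_sub_distrib, ← Finset.mul_sum, ← hsum]
      ring
    · exact fun J _ => (i1 J).sub (i2 J k)
  rw [Finset.sum_congr rfl e1, Finset.sum_comm]
  have e2 : ∀ J : Finset ι, (∑ k ∈ Finset.univ.erase j,
      if k ∈ J then ∫ q, c q * d J q ∂((iidLaw ι ν).prod (iidLaw ι ν)) else 0) =
      (p - 1) * ∫ q, c q * d J q ∂((iidLaw ι ν).prod (iidLaw ι ν)) := fun J => by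
    by_cases hj : j ∈ J
    swap
    · have h0 : ∀ q, d J q = 0 := fun q => by
        simp [hddef, hw.resample_of_disjoint (Finset.disjoint_singleton_left.2 hj)]
      simp [h0]
    by_cases h : J.card = p
    swap
    · have h0 : ∀ q, d J q = 0 := fun q => by simp [hddef, hw.eq_zero J h]
      simp [h0]
    rw [Finset.sum_ite_mem, Finset.sum_const, nsmul_eq_mul]
    have : Finset.univ.erase j ∩ J = J.erase j := by ext i; simp
    have hpos := Finset.card_pos.2 ⟨j, hj⟩
    rw [this, Finset.card_erase_of_mem hj, Nat.cast_sub hpos, h, Nat.cast_one]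
  rw [Finset.sum_congr rfl fun J _ => e2 J, ← Finset.mul_sum, ← integral_finsetSum]
  · congr 2
    funext q
    rw [← Finset.mul_sum, ← hsum]
    simp only [hc]
    ring
  · exact fun J _ => i0 J

/-- The term `k = j` costs at most one fourth moment, since averaging over `j` kills the conditional
expectation. The others, by `signed_sq_sub_sq_le` and symmetrisation, sum to at most `4 (p - 1)`
fourth moments. -/
lemma sum_norm_condLp_sub_sq_le (hw : IsDegenerateFamily ν p w) (hp : 1 ≤ p) (j : ι) :
    ∑ k, ‖condLp (hw.memLp_signedSq j) - avgOp ν {k} (condLp (hw.memLp_signedSq j))‖ ^ 2 ≤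
      4 * p * ∫ q, increment w j q ^ 4 ∂((iidLaw ι ν).prod (iidLaw ι ν)) := by
  have hd := hw.memLp_increment j
  have hm1 : MeasurePreserving (fun r : ((ι → E) × (ι → E)) × (ι → E) => (r.1.1, r.2))
      (((iidLaw ι ν).prod (iidLaw ι ν)).prod (iidLaw ι ν)) ((iidLaw ι ν).prod (iidLaw ι ν)) :=
    measurePreserving_fst.prod (MeasurePreserving.id _)
  have h4 : 0 ≤ ∫ q, increment w j q ^ 4 ∂((iidLaw ι ν).prod (iidLaw ι ν)) :=
    integral_nonneg fun _ => by positivity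
  have h1 : ‖condLp (hw.memLp_signedSq j) -
      avgOp ν {j} (condLp (hw.memLp_signedSq j))‖ ^ 2 ≤
      ∫ q, increment w j q ^ 4 ∂((iidLaw ι ν).prod (iidLaw ι ν)) := by
    rw [avgOp_condLp_eq_zero, sub_zero, ← integral_signedSq_sq]
    · exact norm_condLp_sq_le _
    · intro q
      simp only [signedSq, increment_exchange, abs_neg, neg_mul]
  have h2 : ∀ k ∈ Finset.univ.erase j, ‖condLp (hw.memLp_signedSq j) -
      avgOp ν {k} (condLp (hw.memLp_signedSq j))‖ ^ 2 ≤
      4 * ∫ r, increment w j (r.1.1, r.2) * increment w j (r.1.1, r.2) *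
        increment w j (r.1.1, r.2) * (increment w j (r.1.1, r.2) -
          increment w j (resample {k} r.1.1 r.1.2, r.2))
        ∂(((iidLaw ι ν).prod (iidLaw ι ν)).prod (iidLaw ι ν)) := fun k _ => by
    refine (norm_condLp_sub_avgOp_sq_le _ _).trans ?_
    have hm2 : MeasurePreserving
      (fun r : ((ι → E) × (ι → E)) × (ι → E) => (resample {k} r.1.1 r.1.2, r.2))
      (((iidLaw ι ν).prod (iidLaw ι ν)).prod (iidLaw ι ν)) ((iidLaw ι ν).prod (iidLaw ι ν)) :=
      (measurePreserving_resample {k}).prod (MeasurePreserving.id _)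
    have hm3 : MeasurePreserving (fun r : ((ι → E) × (ι → E)) × (ι → E) =>
        ((resample {k} r.1.1 r.1.2, resample {k} r.1.2 r.1.1), r.2))
        (((iidLaw ι ν).prod (iidLaw ι ν)).prod (iidLaw ι ν))
        (((iidLaw ι ν).prod (iidLaw ι ν)).prod (iidLaw ι ν)) :=
      (measurePreserving_exchange {k}).prod (MeasurePreserving.id _)
    have ha := hd.comp_measurePreserving hm1
    have hb := hd.comp_measurePreserving hm2
    have i1 : Integrable (fun r : ((ι → E) × (ι → E)) × (ι → E) => increment w j (r.1.1, r.2) *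
        increment w j (r.1.1, r.2) *
        increment w j (r.1.1, r.2) * (increment w j (r.1.1, r.2) -
          increment w j (resample {k} r.1.1 r.1.2, r.2)))
        (((iidLaw ι ν).prod (iidLaw ι ν)).prod (iidLaw ι ν)) := by
      simp only [mul_assoc (_ * _)]
      exact (ha.mul_four ha).integrable_mul_two (ha.mul_four (ha.sub hb))
    have i2 := hm3.integrable_comp_of_integrable i1
    have s1 := hm3.integral_comp_ae i1.1
    have i3 : Integrable (fun r : ((ι → E) × (ι → E)) × (ι → E) =>
        (signedSq w j (r.1.1, r.2) - signedSq w j (resample {k} r.1.1 r.1.2, r.2)) ^ 2)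
        (((iidLaw ι ν).prod (iidLaw ι ν)).prod (iidLaw ι ν)) :=
      (((hw.memLp_signedSq j).comp_measurePreserving hm1).sub
        ((hw.memLp_signedSq j).comp_measurePreserving hm2)).integrable_sq
    have s2 := integral_mono i3 ((i1.add i2).const_mul 4) fun r => by
      refine (signed_sq_sub_sq_le _ _).trans (le_of_eq ?_)
      simp only [Pi.add_apply, Function.comp, resample_exchange]
      ring
    rw [integral_const_mul, integral_add' i1 i2] at s2
    simp only [Function.comp_def] at s2
    simp only at s1
    rw [s1] at s2
    linarith
  rw [← Finset.add_sum_erase _ _ (Finset.mem_univ j)]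
  have h3 := Finset.sum_le_sum h2
  rw [← Finset.mul_sum, hw.sum_integral_increment_sub] at h3
  have hp' : (1 : ℝ) ≤ p := by exact_mod_cast hp
  nlinarith

/-- The signed squares of the increments are almost orthogonal to functions of the sample. -/
lemma abs_sum_integral_mul_signedSq_le (hw : IsDegenerateFamily ν p w) (hp : 1 ≤ p)
    {φ : (ι → E) → ℝ} (hφ : MemLp φ 2 (iidLaw ι ν)) (hφ2 : ∀ x, |φ x| ≤ 2) :
    |∑ i, ∫ q, φ q.1 * signedSq w i q ∂((iidLaw ι ν).prod (iidLaw ι ν))| ≤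
      2 * √(4 * p * incrementFourth ν w) := by
  have h1 : ∑ i, ∫ q, φ q.1 * signedSq w i q ∂((iidLaw ι ν).prod (iidLaw ι ν)) =
      inner ℝ (hφ.toLp φ) (∑ i, condLp (hw.memLp_signedSq i)) := by
    rw [inner_sum]
    exact Finset.sum_congr rfl fun i _ => (inner_condLp _ _).symm
  rw [h1]
  refine (abs_real_inner_le_norm _ _).trans (mul_le_mul ?_ ?_ (norm_nonneg _) zero_le_two)
  · refine le_of_sq_le_sq ?_ zero_le_two
    rw [norm_toLp_sq]
    calc ∫ x, φ x ^ 2 ∂(iidLaw ι ν) ≤ ∫ _, (2 : ℝ) ^ 2 ∂(iidLaw ι ν) := by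
          refine integral_mono hφ.integrable_sq (integrable_const _) fun x => ?_
          exact sq_le_sq' (abs_le.1 (hφ2 x)).1 (abs_le.1 (hφ2 x)).2
      _ = _ := by simp
  · refine Real.le_sqrt_of_sq_le ?_
    refine (isProjectionFamily_avgOp.norm_sum_sq_le _ fun i =>
      avgOp_condLp_eq_zero (hw.memLp_signedSq i) fun q => ?_).trans ?_
    · simp only [signedSq, increment_exchange, abs_neg, neg_mul]
    · rw [incrementFourth, Finset.mul_sum]
      exact Finset.sum_le_sum fun j _ => hw.sum_norm_condLp_sub_sq_le hp j

end IsDegenerateFamily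

end SignedSquare

/-! ### Stein's method for the exchangeable pairs and the final estimate. -/

section KolmogorovBound

lemma measurable_indIic (z : ℝ) : Measurable (indIic z) :=
  Measurable.ite measurableSet_Iic measurable_const measurable_const

lemma abs_indIic_le (z x : ℝ) : |indIic z x| ≤ 1 := by
  unfold indIic; split_ifs <;> simp

lemma abs_mul_steinSol_le (z x : ℝ) : |x * steinSol z x| ≤ 1 := by
  have h0 := stdCDF_nonneg z
  have h1 := stdCDF_le_one z
  have h2 := mul_steinSol_le z x
  have h3 := le_mul_steinSol z x
  rw [abs_le]
  constructor <;> linarith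

lemma integral_indIic {α : Type*} [MeasurableSpace α] {μ : Measure α} [IsProbabilityMeasure μ]
    {f : α → ℝ} (hf : AEMeasurable f μ) (z : ℝ) :
    ∫ x, indIic z (f x) ∂μ = μ.real {x | f x ≤ z} := by
  have hs : NullMeasurableSet {x | f x ≤ z} μ := hf.nullMeasurable measurableSet_Iic
  have e : (fun x => indIic z (f x)) = Set.indicator {x | f x ≤ z} fun _ => 1 := by
    funext x
    simp [indIic, Set.indicator]
  rw [e, integral_indicator₀ hs]
  simp

variable {ι E : Type*} [DecidableEq ι] [MeasurableSpace E] [Fintype ι]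

namespace IsDegenerateFamily

variable {ν : Measure E} [IsProbabilityMeasure ν] {p : ℕ} {w : Finset ι → (ι → E) → ℝ}

/-- Exchangeability turns a bound by increments of bounded functions into a single moment. -/
lemma integral_max_sq_mul_sub (hw : IsDegenerateFamily ν p w) (i : ι) {c : ℝ → ℝ}
    (hc : Measurable c) (hc1 : ∀ x, |c x| ≤ 1) :
    (Integrable (fun q : (ι → E) × (ι → E) =>
        max (kernelSum w q.1 - kernelSum w (resample {i} q.1 q.2)) 0 ^ 2 *
        (c (kernelSum w q.1) - c (kernelSum w (resample {i} q.1 q.2))))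
        ((iidLaw ι ν).prod (iidLaw ι ν)) ∧
      ∫ q, max (kernelSum w q.1 - kernelSum w (resample {i} q.1 q.2)) 0 ^ 2 *
        (c (kernelSum w q.1) - c (kernelSum w (resample {i} q.1 q.2)))
        ∂((iidLaw ι ν).prod (iidLaw ι ν)) =
      ∫ q, c (kernelSum w q.1) * signedSq w i q ∂((iidLaw ι ν).prod (iidLaw ι ν))) ∧
    (Integrable (fun q : (ι → E) × (ι → E) =>
        max (kernelSum w (resample {i} q.1 q.2) - kernelSum w q.1) 0 ^ 2 *
        (c (kernelSum w (resample {i} q.1 q.2)) - c (kernelSum w q.1)))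
        ((iidLaw ι ν).prod (iidLaw ι ν)) ∧
      ∫ q, max (kernelSum w (resample {i} q.1 q.2) - kernelSum w q.1) 0 ^ 2 *
        (c (kernelSum w (resample {i} q.1 q.2)) - c (kernelSum w q.1))
        ∂((iidLaw ι ν).prod (iidLaw ι ν)) =
      ∫ q, c (kernelSum w q.1) * signedSq w i q ∂((iidLaw ι ν).prod (iidLaw ι ν))) := by
  have hf := hw.memLp_kernelSum.comp_fst_prod (ρ := iidLaw ι ν)
  have hr := hw.memLp_kernelSum.resample (ν := ν) {i}
  have hd := hw.memLp_increment i
  have hsq : Integrable (fun q => increment w i q ^ 2) ((iidLaw ι ν).prod (iidLaw ι ν)) :=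
    hd.of_four.integrable_sq
  have hcf : AEStronglyMeasurable (fun q : (ι → E) × (ι → E) => c (kernelSum w q.1))
      ((iidLaw ι ν).prod (iidLaw ι ν)) :=
    (hc.comp_aemeasurable hf.1.aemeasurable).aestronglyMeasurable
  have hcr : AEStronglyMeasurable
      (fun q : (ι → E) × (ι → E) => c (kernelSum w (resample {i} q.1 q.2)))
      ((iidLaw ι ν).prod (iidLaw ι ν)) :=
    (hc.comp_aemeasurable hr.1.aemeasurable).aestronglyMeasurable
  have hmax : ∀ s : ℝ, AEStronglyMeasurable (fun q => max (s * increment w i q) 0 ^ 2)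
      ((iidLaw ι ν).prod (iidLaw ι ν)) := fun s =>
    (((hd.1.aemeasurable.const_mul s).max aemeasurable_const).pow_const 2).aestronglyMeasurable
  have hb : ∀ s : ℝ, |s| = 1 → ∀ a : (ι → E) × (ι → E) → ℝ,
      AEStronglyMeasurable a ((iidLaw ι ν).prod (iidLaw ι ν)) → (∀ q, |a q| ≤ 1) →
      Integrable (fun q => max (s * increment w i q) 0 ^ 2 * a q)
        ((iidLaw ι ν).prod (iidLaw ι ν)) := fun s hs a ha ha1 => by
    refine hsq.mono' ((hmax s).mul ha) (Filter.Eventually.of_forall fun q => ?_)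
    rw [Real.norm_eq_abs, abs_mul, abs_of_nonneg (sq_nonneg (max _ _))]
    have h1 : max (s * increment w i q) 0 ≤ |increment w i q| := by
      refine max_le ((le_abs_self _).trans ?_) (abs_nonneg _)
      rw [abs_mul, hs, one_mul]
    have h2 : max (s * increment w i q) 0 ^ 2 ≤ increment w i q ^ 2 := by
      rw [← sq_abs (increment w i q)]
      exact pow_le_pow_left₀ (le_max_right _ _) h1 2
    calc _ ≤ increment w i q ^ 2 * 1 := mul_le_mul h2 (ha1 q) (abs_nonneg _) (sq_nonneg _)
      _ = _ := mul_one _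
  have p1 := hb 1 (by simp) _ hcf fun _ => hc1 _
  have p2 := hb 1 (by simp) _ hcr fun _ => hc1 _
  have m1 := hb (-1) (by simp) _ hcf fun _ => hc1 _
  have m2 := hb (-1) (by simp) _ hcr fun _ => hc1 _
  -- The exchange swaps the two sums and flips the increment. Terms weighted by `c` of the resampled
  -- sum become terms weighted by `c` of the original sum, with the opposite part of the increment;
  -- the two parts combine to the signed square.
  have s1 := integral_exchange {i} p1.1
  have s2 := integral_exchange {i} m1.1
  simp only [increment_exchange, mul_neg, neg_mul, one_mul, neg_neg] at s1 s2 p1 p2 m1 m2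
  have hsig : ∀ q, signedSq w i q =
      max (increment w i q) 0 ^ 2 - max (-increment w i q) 0 ^ 2 := fun q => by
    unfold signedSq
    rcases le_total 0 (increment w i q) with h | h
    · rw [abs_of_nonneg h, max_eq_left h, max_eq_right (by linarith)]; ring
    · rw [abs_of_nonpos h, max_eq_right h, max_eq_left (by linarith)]; ring
  have hT : ∫ q, c (kernelSum w q.1) * signedSq w i q ∂((iidLaw ι ν).prod (iidLaw ι ν)) =
      ∫ q, max (increment w i q) 0 ^ 2 * c (kernelSum w q.1) ∂((iidLaw ι ν).prod (iidLaw ι ν)) -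
      ∫ q, max (-increment w i q) 0 ^ 2 * c (kernelSum w q.1)
        ∂((iidLaw ι ν).prod (iidLaw ι ν)) := by
    rw [← integral_sub p1 m1]
    congr 1; funext q; rw [hsig]; ring
  have n1 : ∀ q : (ι → E) × (ι → E),
      max (kernelSum w q.1 - kernelSum w (resample {i} q.1 q.2)) 0 ^ 2 *
        (c (kernelSum w q.1) - c (kernelSum w (resample {i} q.1 q.2))) =
      max (increment w i q) 0 ^ 2 * c (kernelSum w q.1) -
      max (increment w i q) 0 ^ 2 * c (kernelSum w (resample {i} q.1 q.2)) := fun q => by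
    rw [increment]; ring
  have n2 : ∀ q : (ι → E) × (ι → E),
      max (kernelSum w (resample {i} q.1 q.2) - kernelSum w q.1) 0 ^ 2 *
        (c (kernelSum w (resample {i} q.1 q.2)) - c (kernelSum w q.1)) =
      max (-increment w i q) 0 ^ 2 * c (kernelSum w (resample {i} q.1 q.2)) -
      max (-increment w i q) 0 ^ 2 * c (kernelSum w q.1) := fun q => by
    rw [increment, neg_sub]; ring
  simp only [n1, n2]
  refine ⟨⟨p1.sub p2, ?_⟩, ⟨m2.sub m1, ?_⟩⟩
  · rw [integral_sub p1 p2, hT, s2]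
  · rw [integral_sub m2 m1, hT, s1]

lemma abs_steinSol_le (z x : ℝ) : |steinSol z x| ≤ |steinSol z 0| + 3 * |x| := by
  have h := abs_steinSol_sub_le z x 0
  rw [sub_zero] at h
  have := abs_sub_abs_le_abs_sub (steinSol z x) (steinSol z 0)
  linarith

lemma memLp_steinSol (hw : IsDegenerateFamily ν p w) (z : ℝ) :
    MemLp (fun x => steinSol z (kernelSum w x)) 4 (iidLaw ι ν) := by
  have h4 := hw.memLp_kernelSum
  have h0 : MemLp (fun _ : ι → E => |steinSol z 0|) 4 (iidLaw ι ν) := memLp_const _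
  have h1 : MemLp (fun x => 3 * |kernelSum w x|) 4 (iidLaw ι ν) := h4.abs.const_mul 3
  refine (h0.add h1).of_le ((continuous_steinSol z).comp_aestronglyMeasurable h4.1)
    (Filter.Eventually.of_forall fun x => ?_)
  exact (abs_steinSol_le z _).trans (le_abs_self _)

/-- The eigenvector identity tested against the Stein solution, then antisymmetrised using
exchangeability. -/
lemma integral_mul_steinSol (hw : IsDegenerateFamily ν p w) (z : ℝ) :
    p * ∫ x, kernelSum w x * steinSol z (kernelSum w x) ∂(iidLaw ι ν) =
      1 / 2 * ∑ i, ∫ q, increment w i q * (steinSol z (kernelSum w q.1) -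
        steinSol z (kernelSum w (resample {i} q.1 q.2))) ∂((iidLaw ι ν).prod (iidLaw ι ν)) := by
  have hs := hw.memLp_steinSol z
  have h := hw.sum_integral_mul_sub hs.of_four (memLp_const 1)
  simp only [mul_one] at h
  have h1 : ∀ i, ∫ q, steinSol z (kernelSum w q.1) *
        (kernelSum w q.1 - kernelSum w (resample {i} q.1 q.2)) ∂((iidLaw ι ν).prod (iidLaw ι ν)) =
      1 / 2 * ∫ q, increment w i q * (steinSol z (kernelSum w q.1) -
        steinSol z (kernelSum w (resample {i} q.1 q.2))) ∂((iidLaw ι ν).prod (iidLaw ι ν)) :=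
    fun i => by
    have i1 : Integrable (fun q : (ι → E) × (ι → E) => steinSol z (kernelSum w q.1) *
        (kernelSum w q.1 - kernelSum w (resample {i} q.1 q.2)))
        ((iidLaw ι ν).prod (iidLaw ι ν)) :=
      hs.of_four.comp_fst_prod.integrable_mul_two (hw.memLp_increment i).of_four
    have i2 := (measurePreserving_exchange (ν := ν) {i}).integrable_comp_of_integrable i1
    have s1 := integral_exchange {i} i1.1
    have t := integral_add i1 i2
    simp only [Function.comp_def] at t
    rw [s1] at t
    have e : ∫ q, increment w i q * (steinSol z (kernelSum w q.1) -
        steinSol z (kernelSum w (resample {i} q.1 q.2))) ∂((iidLaw ι ν).prod (iidLaw ι ν)) =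
        _ := Eq.trans (integral_congr_ae (Filter.Eventually.of_forall fun q => ?_)) t
    · rw [e]; ring
    · simp only [resample_exchange, increment]
      ring
  rw [Finset.sum_congr rfl fun i _ => h1 i, ← Finset.mul_sum] at h
  rw [h]
  congr 2; funext x; ring

/-- Integrate the two pointwise bounds on the increment error. By `integral_max_sq_mul_sub` the
positive and negative parts give the same moment, so the bounds collapse to plus and minus one
integral, to which cancellation can be applied after summation over `i`. -/
lemma abs_integral_increment_error_le (hw : IsDegenerateFamily ν p w) (z : ℝ) (i : ι) :
    |∫ q, (increment w i q * (steinSol z (kernelSum w q.1) -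
        steinSol z (kernelSum w (resample {i} q.1 q.2))) -
        increment w i q ^ 2 * steinDeriv z (kernelSum w q.1))
        ∂((iidLaw ι ν).prod (iidLaw ι ν))| ≤
      ∫ q, steinWeight z (kernelSum w q.1) * signedSq w i q
        ∂((iidLaw ι ν).prod (iidLaw ι ν)) := by
  have hf := hw.memLp_kernelSum.comp_fst_prod (ρ := iidLaw ι ν)
  have hd := hw.memLp_increment i
  have hs := hw.memLp_steinSol z
  have hmm : Measurable fun x => x * steinSol z x :=
    measurable_id.mul (continuous_steinSol z).measurable
  have hmd : Measurable (steinDeriv z) :=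
    (hmm.add (measurable_indIic z)).sub_const _
  have A := hw.integral_max_sq_mul_sub i hmm (abs_mul_steinSol_le z)
  have B := hw.integral_max_sq_mul_sub i (measurable_indIic z) (abs_indIic_le z)
  have hsq : Integrable (fun q => increment w i q ^ 2) ((iidLaw ι ν).prod (iidLaw ι ν)) :=
    hd.of_four.integrable_sq
  have i1 : Integrable (fun q : (ι → E) × (ι → E) =>
      increment w i q ^ 2 * steinDeriv z (kernelSum w q.1)) ((iidLaw ι ν).prod (iidLaw ι ν)) := by
    refine hsq.mono' (hsq.1.mul (hmd.comp_aemeasurable hf.1.aemeasurable).aestronglyMeasurable)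
      (Filter.Eventually.of_forall fun q => ?_)
    rw [Real.norm_eq_abs, abs_mul, abs_of_nonneg (sq_nonneg _)]
    exact mul_le_of_le_one_right (sq_nonneg _) (abs_steinDeriv_le _ _)
  have i2 : Integrable (fun q : (ι → E) × (ι → E) => increment w i q *
      (steinSol z (kernelSum w q.1) - steinSol z (kernelSum w (resample {i} q.1 q.2))))
      ((iidLaw ι ν).prod (iidLaw ι ν)) :=
    hd.of_four.integrable_mul_two (hs.of_four.comp_fst_prod.sub (hs.of_four.resample {i}))
  have hcf : ∀ {c : ℝ → ℝ}, Measurable c → (∀ x, |c x| ≤ 1) → Integrable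
      (fun q : (ι → E) × (ι → E) => c (kernelSum w q.1) * signedSq w i q)
      ((iidLaw ι ν).prod (iidLaw ι ν)) := fun {c} hc hc1 => by
    have hi := (hw.memLp_signedSq i).integrable one_le_two
    refine hi.abs.mono' ((hc.comp_aemeasurable hf.1.aemeasurable).aestronglyMeasurable.mul hi.1)
      (Filter.Eventually.of_forall fun q => ?_)
    rw [Real.norm_eq_abs, abs_mul]
    exact mul_le_of_le_one_left (abs_nonneg _) (hc1 _)
  have eT : ∫ q, steinWeight z (kernelSum w q.1) * signedSq w i q
        ∂((iidLaw ι ν).prod (iidLaw ι ν)) =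
      ∫ q, kernelSum w q.1 * steinSol z (kernelSum w q.1) * signedSq w i q
        ∂((iidLaw ι ν).prod (iidLaw ι ν)) -
      ∫ q, indIic z (kernelSum w q.1) * signedSq w i q ∂((iidLaw ι ν).prod (iidLaw ι ν)) := by
    rw [← integral_sub (hcf hmm (abs_mul_steinSol_le z))
      (hcf (measurable_indIic z) (abs_indIic_le z))]
    congr 1; funext q; rw [steinWeight]; ring
  rw [eT, abs_le]
  constructor
  · have h := integral_mono ((A.1.1.neg).sub (B.2.1.neg)) (i2.sub i1) fun q => ?_
    · rw [integral_sub' A.1.1.neg B.2.1.neg, integral_neg', integral_neg', A.1.2, B.2.2] at h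
      simp only [Pi.sub_apply] at h
      linarith
    · have := stein_increment_lower z (kernelSum w q.1) (kernelSum w (resample {i} q.1 q.2))
      simp only [Pi.sub_apply, Pi.neg_apply, increment]
      linarith
  · have h := integral_mono (i2.sub i1) ((A.2.1).sub B.1.1) fun q => ?_
    · rw [integral_sub' A.2.1 B.1.1, A.2.2, B.1.2] at h
      simp only [Pi.sub_apply] at h
      linarith
    · have := stein_increment_upper z (kernelSum w q.1) (kernelSum w (resample {i} q.1 q.2))
      simp only [Pi.sub_apply, increment]
      linarith

/-- The exchangeable pairs bound on the distance to the normal distribution. -/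
lemma abs_measure_sub_stdCDF_le (hw : IsDegenerateFamily ν p w) (hp : 1 ≤ p) (z : ℝ) :
    |(iidLaw ι ν).real {x | kernelSum w x ≤ z} - stdCDF z| ≤
      ‖hw.midLp‖ + (p : ℝ)⁻¹ * √(4 * p * incrementFourth ν w) := by
  have hp' : (0 : ℝ) < p := by exact_mod_cast hp
  have h4 := hw.memLp_kernelSum
  have hs := hw.memLp_steinSol z
  have hmm : Measurable fun x => x * steinSol z x :=
    measurable_id.mul (continuous_steinSol z).measurable
  have hmd : Measurable (steinDeriv z) := (hmm.add (measurable_indIic z)).sub_const _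
  have hmw : Measurable (steinWeight z) := hmm.sub (measurable_indIic z)
  have hφ : MemLp (fun x => steinDeriv z (kernelSum w x)) 2 (iidLaw ι ν) :=
    MemLp.of_bound (hmd.comp_aemeasurable h4.1.aemeasurable).aestronglyMeasurable 1
      (Filter.Eventually.of_forall fun x => abs_steinDeriv_le z _)
  have hψ : MemLp (fun x => steinWeight z (kernelSum w x)) 2 (iidLaw ι ν) :=
    MemLp.of_bound (hmw.comp_aemeasurable h4.1.aemeasurable).aestronglyMeasurable 2
      (Filter.Eventually.of_forall fun x => abs_steinWeight_le z _)
  have hprod : Integrable (fun x => kernelSum w x * steinSol z (kernelSum w x)) (iidLaw ι ν) :=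
    h4.of_four.integrable_mul_two hs.of_four
  have hind : Integrable (fun x => indIic z (kernelSum w x)) (iidLaw ι ν) :=
    Integrable.of_bound
      ((measurable_indIic z).comp_aemeasurable h4.1.aemeasurable).aestronglyMeasurable 1
      (Filter.Eventually.of_forall fun x => abs_indIic_le z _)
  -- Stein's equation, integrated.
  have e1 : (iidLaw ι ν).real {x | kernelSum w x ≤ z} - stdCDF z =
      ∫ x, steinDeriv z (kernelSum w x) ∂(iidLaw ι ν) -
      ∫ x, kernelSum w x * steinSol z (kernelSum w x) ∂(iidLaw ι ν) := by
    have h1 : ∫ x, steinDeriv z (kernelSum w x) ∂(iidLaw ι ν) =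
        ∫ x, kernelSum w x * steinSol z (kernelSum w x) ∂(iidLaw ι ν) +
        ∫ x, indIic z (kernelSum w x) ∂(iidLaw ι ν) - stdCDF z := by
      have h2 := integral_sub (hprod.add hind) (integrable_const (μ := iidLaw ι ν) (stdCDF z))
      rw [integral_add' hprod hind] at h2
      simpa [steinDeriv] using h2
    rw [h1, integral_indIic h4.1.aemeasurable]
    ring
  have hA := hw.abs_integral_sub_le hp hφ fun x => abs_steinDeriv_le z _
  have hB := hw.abs_sum_integral_mul_signedSq_le hp hψ fun x => abs_steinWeight_le z _
  have hC : |∑ i, ∫ q, (increment w i q * (steinSol z (kernelSum w q.1) -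
        steinSol z (kernelSum w (resample {i} q.1 q.2))) -
        increment w i q ^ 2 * steinDeriv z (kernelSum w q.1))
        ∂((iidLaw ι ν).prod (iidLaw ι ν))| ≤ 2 * √(4 * p * incrementFourth ν w) :=
    (Finset.abs_sum_le_sum_abs _ _).trans ((Finset.sum_le_sum fun i _ =>
      hw.abs_integral_increment_error_le z i).trans ((le_abs_self _).trans hB))
  have e2 : ∀ i, ∫ q, (increment w i q * (steinSol z (kernelSum w q.1) -
        steinSol z (kernelSum w (resample {i} q.1 q.2))) -
        increment w i q ^ 2 * steinDeriv z (kernelSum w q.1))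
        ∂((iidLaw ι ν).prod (iidLaw ι ν)) =
      ∫ q, increment w i q * (steinSol z (kernelSum w q.1) -
        steinSol z (kernelSum w (resample {i} q.1 q.2))) ∂((iidLaw ι ν).prod (iidLaw ι ν)) -
      ∫ q, steinDeriv z (kernelSum w q.1) * increment w i q ^ 2
        ∂((iidLaw ι ν).prod (iidLaw ι ν)) := fun i => by
    have hd := hw.memLp_increment i
    have hf := h4.comp_fst_prod (ρ := iidLaw ι ν)
    have i2 : Integrable (fun q : (ι → E) × (ι → E) => increment w i q *
        (steinSol z (kernelSum w q.1) - steinSol z (kernelSum w (resample {i} q.1 q.2))))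
        ((iidLaw ι ν).prod (iidLaw ι ν)) :=
      hd.of_four.integrable_mul_two (hs.of_four.comp_fst_prod.sub (hs.of_four.resample {i}))
    have i1 : Integrable (fun q : (ι → E) × (ι → E) =>
        steinDeriv z (kernelSum w q.1) * increment w i q ^ 2)
        ((iidLaw ι ν).prod (iidLaw ι ν)) := by
      simp_rw [sq]
      exact hφ.comp_fst_prod.integrable_mul_two (hd.mul_four hd)
    rw [← integral_sub i2 i1]
    congr 1; funext q; ring
  rw [Finset.sum_congr rfl fun i _ => e2 i, Finset.sum_sub_distrib] at hC
  have e3 := hw.integral_mul_steinSol z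
  set S1 := ∑ i, ∫ q, increment w i q * (steinSol z (kernelSum w q.1) -
        steinSol z (kernelSum w (resample {i} q.1 q.2))) ∂((iidLaw ι ν).prod (iidLaw ι ν))
  set S2 := ∑ i, ∫ q, steinDeriv z (kernelSum w q.1) * increment w i q ^ 2
        ∂((iidLaw ι ν).prod (iidLaw ι ν))
  have e4 : ∫ x, kernelSum w x * steinSol z (kernelSum w x) ∂(iidLaw ι ν) =
      (2 * p : ℝ)⁻¹ * S1 := by
    field_simp
    linarith
  rw [e1, e4]
  -- Separates the fluctuation of the carré du champ around `2p` from the linearisation error of the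
  -- Stein solution.
  have e5 : ∫ x, steinDeriv z (kernelSum w x) ∂(iidLaw ι ν) - (2 * p : ℝ)⁻¹ * S1 =
      (∫ x, steinDeriv z (kernelSum w x) ∂(iidLaw ι ν) - (2 * p : ℝ)⁻¹ * S2) -
      (2 * p : ℝ)⁻¹ * (S1 - S2) := by ring
  rw [e5]
  refine (abs_sub _ _).trans (add_le_add hA ?_)
  rw [abs_mul, abs_of_nonneg (by positivity : (0 : ℝ) ≤ (2 * p : ℝ)⁻¹)]
  calc (2 * p : ℝ)⁻¹ * |S1 - S2| ≤ (2 * p : ℝ)⁻¹ * (2 * √(4 * p * incrementFourth ν w)) := by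
        gcongr
    _ = _ := by field_simp

/-- The Kolmogorov distance of a degenerate kernel sum to the normal distribution. -/
theorem abs_measure_sub_stdCDF_le_fourth_moment (hw : IsDegenerateFamily ν p w) (hp : 1 ≤ p)
    (hvar : ∫ x, kernelSum w x ^ 2 ∂(iidLaw ι ν) = 1) [Nonempty ι] (z : ℝ) :
    |(iidLaw ι ν).real {x | kernelSum w x ≤ z} - stdCDF z| ≤
      12 * √|(∫ x, kernelSum w x ^ 4 ∂(iidLaw ι ν)) - 3| + 19 * (p / √(Fintype.card ι)) := by
  have hp' : (0 : ℝ) < p := by exact_mod_cast hp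
  have hn : (0 : ℝ) < Fintype.card ι := by exact_mod_cast Fintype.card_pos
  have e0 : ‖hw.sqLp‖ ^ 2 = ∫ x, kernelSum w x ^ 4 ∂(iidLaw ι ν) := by
    rw [sqLp, norm_toLp_sq]
    congr 1; funext x; ring
  have h1 := hw.norm_midLp_sq_le hp hvar
  have h2 := hw.incrementFourth_le hp hvar
  rw [e0] at h1 h2
  set δ := |(∫ x, kernelSum w x ^ 4 ∂(iidLaw ι ν)) - 3|
  set x := √δ
  set y := (p : ℝ) / √(Fintype.card ι) with hy
  have hx2 : x ^ 2 = δ := Real.sq_sqrt (abs_nonneg _)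
  have hy2 : y ^ 2 = (p : ℝ) ^ 2 / Fintype.card ι := by
    rw [hy, div_pow, Real.sq_sqrt hn.le]
  have hx0 : 0 ≤ x := Real.sqrt_nonneg _
  have hy0 : 0 ≤ y := by positivity
  rw [← hy2, ← hx2] at h1 h2
  have h3 : ‖hw.midLp‖ ≤ x + 2 * y := by
    refine le_of_sq_le_sq ?_ (by positivity)
    nlinarith [mul_nonneg hx0 hy0]
  have h4 : (p : ℝ)⁻¹ * √(4 * p * incrementFourth ν w) ≤ 6 * x + 10 * y := by
    rw [inv_mul_le_iff₀ hp']
    refine Real.sqrt_le_iff.2 ⟨by positivity, ?_⟩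
    calc 4 * p * incrementFourth ν w ≤ 4 * p * (p * (8 * x ^ 2 + 24 * y ^ 2)) := by gcongr
      _ = p ^ 2 * (32 * x ^ 2 + 96 * y ^ 2) := by ring
      _ ≤ p ^ 2 * (6 * x + 10 * y) ^ 2 := by
        gcongr
        nlinarith [mul_nonneg hx0 hy0]
      _ = _ := by ring
  -- The two errors add up to `7 * x + 12 * y`, which leaves room in the stated constants.
  refine (hw.abs_measure_sub_stdCDF_le hp z).trans ?_
  linarith

end IsDegenerateFamily

end KolmogorovBound

/-! ### From the Hoeffding decomposition on `Ω` to kernels on the product space. -/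

section Transfer

lemma exists_perm_comp_eq {κ ι : Type*} {e₁ e₂ : κ → ι}
    (h₁ : Function.Injective e₁) (h₂ : Function.Injective e₂) (h : Set.range e₂ = Set.range e₁) :
    ∃ s : Equiv.Perm κ, ∀ k, e₁ (s k) = e₂ k := by
  refine ⟨(Equiv.ofInjective e₂ h₂).trans ((Equiv.setCongr h).trans (Equiv.ofInjective e₁ h₁).symm),
    fun k => ?_⟩
  simp [Equiv.apply_ofInjective_symm]

/-- The kernels `ψ(x_i, i ∈ J)`, `|J| = p`, extended by `0` to all index sets `J`. -/
noncomputable def symmetricKernels {E : Type*} {n : ℕ} (p : ℕ) (ψ : (Fin p → E) → ℝ)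
    (J : Finset (Fin n)) (x : Fin n → E) : ℝ :=
  if h : J.card = p then ψ fun k => x (J.orderEmbOfFin h k) else 0

variable {E : Type*} {n p : ℕ} {ψ : (Fin p → E) → ℝ}

lemma symmetricKernels_of_card {J : Finset (Fin n)} (h : J.card = p) (x : Fin n → E) :
    symmetricKernels p ψ J x = ψ fun k => x (J.orderEmbOfFin h k) := dif_pos h

lemma symmetricKernels_of_card_ne {J : Finset (Fin n)} (h : J.card ≠ p) :
    symmetricKernels (E := E) p ψ J = 0 := by
  funext x; exact dif_neg h

lemma symmetricKernels_congr {J : Finset (Fin n)} {x y : Fin n → E} (h : ∀ i ∈ J, x i = y i) :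
    symmetricKernels p ψ J x = symmetricKernels p ψ J y := by
  unfold symmetricKernels
  split_ifs with hJ
  · congr 1; funext k; exact h _ (J.orderEmbOfFin_mem hJ k)
  · rfl

/-- Relabelling the coordinates only changes the order in which the arguments are plugged in, and
the symmetry of `ψ` absorbs the resulting permutation. -/
lemma symmetricKernels_perm (hψ : ∀ (s : Equiv.Perm (Fin p)) x, ψ (fun k => x (s k)) = ψ x)
    (σ : Equiv.Perm (Fin n)) (J : Finset (Fin n)) (x : Fin n → E) :
    symmetricKernels p ψ J (x ∘ σ) = symmetricKernels p ψ (J.map σ.toEmbedding) x := by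
  by_cases hJ : J.card = p
  swap
  · rw [symmetricKernels_of_card_ne hJ, symmetricKernels_of_card_ne (by rwa [Finset.card_map])]
    rfl
  have hJ' : (J.map σ.toEmbedding).card = p := by rwa [Finset.card_map]
  rw [symmetricKernels_of_card hJ, symmetricKernels_of_card hJ']
  obtain ⟨s, hs⟩ := exists_perm_comp_eq (e₁ := (J.map σ.toEmbedding).orderEmbOfFin hJ')
    (e₂ := fun k => σ (J.orderEmbOfFin hJ k)) ((J.map σ.toEmbedding).orderEmbOfFin hJ').injective
    (σ.injective.comp (J.orderEmbOfFin hJ).injective) (by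
      change Set.range (σ ∘ J.orderEmbOfFin hJ) = _
      rw [Set.range_comp, Finset.range_orderEmbOfFin, Finset.range_orderEmbOfFin]
      simp)
  refine Eq.trans ?_ (hψ s _)
  simp only [hs, Function.comp]

variable [MeasurableSpace E]

lemma measurable_symmetricKernels (hψ : Measurable ψ) (J : Finset (Fin n)) :
    Measurable (symmetricKernels p ψ J) := by
  unfold symmetricKernels
  split_ifs with h
  · exact hψ.comp (measurable_pi_lambda _ fun k => measurable_pi_apply _)
  · exact measurable_const

variable {Ω : Type*} [MeasurableSpace Ω] {μ : Measure Ω} [IsProbabilityMeasure μ]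

lemma subfamilySigma_le {X : Fin n → Ω → E} (hX : ∀ i, Measurable (X i)) (J : Finset (Fin n)) :
    subfamilySigma X J ≤ (inferInstance : MeasurableSpace Ω) :=
  iSup₂_le fun i _ => (hX i).comap_le

/-- The components of minimal order of a Hoeffding decomposition are conditional expectations. -/
lemma IsHoeffdingDecomposition.condExp_eq {X : Fin n → Ω → E} (hX : ∀ i, Measurable (X i))
    {W : Ω → ℝ} {H : Finset (Fin n) → Ω → ℝ} (hH : IsHoeffdingDecomposition X μ W H)
    (h0 : ∀ J : Finset (Fin n), J.card ≠ p → H J =ᵐ[μ] 0) {J : Finset (Fin n)} (hJ : J.card = p) :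
    μ[W | subfamilySigma X J] =ᵐ[μ] H J := by
  have h1 : μ[W | subfamilySigma X J] =ᵐ[μ] μ[∑ K, H K | subfamilySigma X J] :=
    condExp_congr_ae (hH.eq_sum.trans (Filter.Eventually.of_forall fun ω => by simp))
  have h2 : μ[∑ K, H K | subfamilySigma X J] =ᵐ[μ] ∑ K, μ[H K | subfamilySigma X J] :=
    condExp_finsetSum (fun K _ => hH.integrable K) _
  -- Either `K ⊄ J` and degeneracy applies, or `K` is a proper subset of `J`, too small to carry a
  -- component.
  have h3 : ∀ K, K ≠ J → μ[H K | subfamilySigma X J] =ᵐ[μ] 0 := fun K hK => by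
    by_cases hs : K ⊆ J
    · have hc : K.card ≠ p := fun hc => hK (Finset.eq_of_subset_of_card_le hs (by omega))
      have h4 := condExp_congr_ae (m := subfamilySigma X J) (h0 K hc)
      rwa [condExp_zero] at h4
    · exact hH.condExp_eq_zero K J hs
  have h4 : ∀ᵐ ω ∂μ, ∀ K, K ≠ J → (μ[H K | subfamilySigma X J]) ω = 0 := by
    rw [ae_all_iff]
    intro K
    by_cases hK : K = J
    · exact Filter.Eventually.of_forall fun ω h => absurd hK h
    · filter_upwards [h3 K hK] with ω h _ using h
  have h5 : μ[H J | subfamilySigma X J] = H J :=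
    condExp_of_stronglyMeasurable (subfamilySigma_le hX J) (hH.measurable J).stronglyMeasurable
      (hH.integrable J)
  filter_upwards [h1, h2, h4] with ω g1 g2 g4
  rw [g1, g2, Finset.sum_apply, Finset.sum_eq_single J]
  · rw [h5]
  · exact fun K _ hK => g4 K hK
  · simp

lemma measurePreserving_of_iid {X : Fin n → Ω → E} (hX : ∀ i, Measurable (X i))
    (hindep : iIndepFun X μ) (hident : ∀ i j, IdentDistrib (X i) (X j) μ μ) (i₀ : Fin n) :
    MeasurePreserving (fun ω i => X i ω) μ (iidLaw (Fin n) (μ.map (X i₀))) := by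
  refine ⟨measurable_pi_lambda _ hX, ?_⟩
  rw [(iIndepFun_iff_map_fun_eq_pi_map fun i => (hX i).aemeasurable).1 hindep]
  congr 1
  funext i
  exact (hident i i₀).map_eq

/-- A kernel whose conditional expectations vanish is annihilated by averaging. -/
lemma avg_eq_zero_of_condExp {ν : Measure E} [IsProbabilityMeasure ν] {X : Fin n → Ω → E}
    (hX : ∀ i, Measurable (X i))
    (hmp : MeasurePreserving (fun ω i => X i ω) μ (iidLaw (Fin n) ν)) {v : (Fin n → E) → ℝ}
    (hvm : Measurable v) (hv : MemLp v 2 (iidLaw (Fin n) ν)) {i : Fin n}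
    (h : μ[fun ω => v (fun k => X k ω) | subfamilySigma X {i}ᶜ] =ᵐ[μ] 0) :
    avg ν {i} v =ᵐ[iidLaw (Fin n) ν] 0 := by
  set u := avg ν {i} v with hu
  have hu2 : MemLp u 2 (iidLaw (Fin n) ν) := memLp_avg hv _
  have hum : Measurable u := by
    have : StronglyMeasurable fun q : (Fin n → E) × (Fin n → E) => v (resample {i} q.1 q.2) :=
      (hvm.comp (measurable_resample {i})).stronglyMeasurable
    exact this.integral_prod_right'.measurable
  -- The average does not depend on coordinate `i`, so that coordinate may be frozen at its value
  -- for a fixed `ω₀`.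
  have hsm : Measurable[subfamilySigma X {i}ᶜ] fun ω => u (fun k => X k ω) := by
    obtain ⟨ω₀⟩ : Nonempty Ω := nonempty_of_isProbabilityMeasure μ
    have e : (fun ω => u (fun k => X k ω)) =
        fun ω => u (fun k => if k = i then X i ω₀ else X k ω) := by
      funext ω
      simp only [hu, avg]
      congr 1; funext y; congr 1; funext k
      simp only [resample, Finset.mem_singleton]
      split_ifs <;> rfl
    have hT : Measurable[subfamilySigma X {i}ᶜ] fun ω k => if k = i then X i ω₀ else X k ω := by
      refine @measurable_pi_lambda _ _ _ (subfamilySigma X {i}ᶜ) _ _ fun k => ?_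
      by_cases hk : k = i
      · simp only [hk, if_true]; exact measurable_const
      · simp only [hk, if_false]
        refine Measurable.mono (comap_measurable (X k)) ?_ le_rfl
        exact le_iSup₂_of_le k (by simpa using hk) le_rfl
    rw [e]
    have hc : Measurable[subfamilySigma X {i}ᶜ] (u ∘ fun ω k => if k = i then X i ω₀ else X k ω) :=
      @Measurable.comp _ _ _ (subfamilySigma X {i}ᶜ) _ _ _ _ hum hT
    exact hc
  have huX : MemLp (fun ω => u (fun k => X k ω)) 2 μ := hu2.comp_measurePreserving hmp
  have hvX : MemLp (fun ω => v (fun k => X k ω)) 2 μ := hv.comp_measurePreserving hmp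
  have h1 : ∫ x, u x * v x ∂(iidLaw (Fin n) ν) = 0 := by
    rw [← hmp.integral_comp_ae (hu2.integrable_mul_two hv).1]
    have hle := subfamilySigma_le hX ({i}ᶜ : Finset (Fin n))
    rw [← integral_condExp hle]
    refine integral_eq_zero_of_ae ?_
    have h2 := condExp_mul_of_stronglyMeasurable_left (μ := μ) hsm.stronglyMeasurable
      (huX.integrable_mul_two hvX) (hvX.integrable one_le_two)
    refine h2.trans ?_
    filter_upwards [h] with ω hω
    simp [hω]
  -- As `u` is the orthogonal projection of `v`, its squared norm is `⟨u, v⟩`, which conditioning on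
  -- the other variables has shown to vanish.
  have h2 : ‖hu2.toLp u‖ ^ 2 = 0 := by
    have e : hu2.toLp u = avgOp ν {i} (hv.toLp v) := (avgOp_toLp hv {i}).symm
    rw [← real_inner_self_eq_norm_sq]
    conv_lhs => rw [e]
    rw [← h1, ← inner_toLp_toLp hu2 hv, e, inner_avgOp_symm, avgOp_avgOp, Finset.union_self,
      real_inner_comm]
  have h3 : hu2.toLp u = 0 := norm_eq_zero.1 ((pow_eq_zero_iff two_ne_zero).1 h2)
  have h4 := hu2.coeFn_toLp
  rw [h3] at h4
  exact h4.symm.trans (Lp.coeFn_zero _ _ _)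

end Transfer

theorem corollary1 {Ω E : Type*} [MeasurableSpace Ω] [MeasurableSpace E]
    (μ : Measure Ω) [IsProbabilityMeasure μ]
    (p n : ℕ) (hp : 1 ≤ p) (hpn : p ≤ n)
    (X : Fin n → Ω → E) (hX : ∀ i, Measurable (X i))
    (hindep : iIndepFun X μ) (hident : ∀ i j, IdentDistrib (X i) (X j) μ μ)
    (f : (Fin n → E) → ℝ) (hf : Measurable f)
    (W : Ω → ℝ) (hW : W = fun ω => f (fun i => X i ω))
    (hL4 : MemLp W 4 μ)
    (hdeg : IsDegenerateSymmetricUStatistic p X μ W)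
    (hvar : variance W μ = 1) :
    (⨆ t : ℝ, |μ.real {ω | W ω ≤ t} - cdf (gaussianReal 0 1) t|) ≤
      12 * Real.sqrt |(∫ ω, (W ω) ^ 4 ∂μ) - 3| + 19 * ((p : ℝ) / Real.sqrt (n : ℝ)) := by
  obtain ⟨H, ψ, hH, hψm, hψ, h0, hHψ⟩ := hdeg
  let i₀ : Fin n := ⟨0, by omega⟩
  set ν := μ.map (X i₀) with hν
  have : IsProbabilityMeasure ν := Measure.isProbabilityMeasure_map (hX i₀).aemeasurable
  have : Nonempty (Fin n) := ⟨i₀⟩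
  have hmp := measurePreserving_of_iid hX hindep hident i₀
  rw [← hν] at hmp
  set w : Finset (Fin n) → (Fin n → E) → ℝ := symmetricKernels p ψ with hwdef
  have hwm : ∀ J, Measurable (w J) := measurable_symmetricKernels hψm
  have hHw : ∀ J, H J =ᵐ[μ] fun ω => w J (fun k => X k ω) := fun J => by
    by_cases hJ : J.card = p
    · filter_upwards [hHψ J hJ] with ω hω
      rw [hω, hwdef, symmetricKernels_of_card hJ]
    · filter_upwards [h0 J hJ] with ω hω
      rw [hω, hwdef, symmetricKernels_of_card_ne hJ]
      rfl
  -- The decomposition only provides integrable components. Fourth moments come from writing a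
  -- component of size `p` as a conditional expectation of `W`, a contraction of `L⁴`.
  have hw4 : ∀ J, MemLp (w J) 4 (iidLaw (Fin n) ν) := fun J => by
    by_cases hJ : J.card = p
    · rw [← hmp.map_eq, memLp_map_measure_iff (hwm J).aestronglyMeasurable hmp.aemeasurable]
      exact (hL4.condExp (m := subfamilySigma X J) (by norm_num)).ae_eq
        ((hH.condExp_eq hX h0 hJ).trans (hHw J))
    · rw [hwdef, symmetricKernels_of_card_ne hJ]
      exact MemLp.zero
  have hw : IsDegenerateFamily ν p w :=
    { memLp := hw4
      eq_of_eqOn := fun J x y h => symmetricKernels_congr h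
      avg_eq_zero := fun J i hi => avg_eq_zero_of_condExp hX hmp (hwm J) (hw4 J).of_four <|
        (condExp_congr_ae (hHw J).symm).trans
          (hH.condExp_eq_zero J {i}ᶜ fun h => by simpa using h hi)
      perm := symmetricKernels_perm hψ
      eq_zero := fun J hJ => symmetricKernels_of_card_ne hJ }
  have hWw : W =ᵐ[μ] fun ω => kernelSum w (fun k => X k ω) := by
    have h1 : ∀ᵐ ω ∂μ, ∀ J, H J ω = w J (fun k => X k ω) := ae_all_iff.2 hHw
    filter_upwards [hH.eq_sum, h1] with ω g1 g2
    rw [g1, kernelSum, Finset.sum_congr rfl fun J _ => g2 J]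
  have hS := hw.memLp_kernelSum
  have hint : ∀ k : ℕ, ∫ ω, W ω ^ k ∂μ = ∫ x, kernelSum w x ^ k ∂(iidLaw (Fin n) ν) := fun k => by
    rw [← hmp.integral_comp_ae (g := fun x => kernelSum w x ^ k) (hS.1.pow k)]
    refine integral_congr_ae ?_
    filter_upwards [hWw] with ω hω
    rw [hω]
  -- Since `1 ≤ p` there is no constant component, and every other kernel averages to zero; thus
  -- unit variance becomes unit second moment.
  have hmean : ∫ ω, W ω ∂μ = 0 := by
    have h1 := hint 1
    simp only [pow_one] at h1
    rw [h1]
    simp only [kernelSum]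
    rw [integral_finsetSum _ fun J _ => (hw4 J).integrable (by norm_num)]
    refine Finset.sum_eq_zero fun J _ => ?_
    rcases J.eq_empty_or_nonempty with rfl | hJ
    · rw [hw.eq_zero ∅ (by rw [Finset.card_empty]; omega)]
      simp
    · obtain ⟨i, hi⟩ := hJ
      have h3 := hw.integral_mul_resample_eq_zero (memLp_const 1) (memLp_const 1) hi
      simp only [one_mul] at h3
      rw [← h3]
      exact ((measurePreserving_resample {i}).integral_comp_ae (hw4 J).1).symm
  have hv : ∫ x, kernelSum w x ^ 2 ∂(iidLaw (Fin n) ν) = 1 := by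
    rw [← hint 2, ← hvar, variance_eq_sub hL4.of_four, hmean]
    simp
  refine ciSup_le fun t => ?_
  have hmeas : μ.real {ω | W ω ≤ t} = (iidLaw (Fin n) ν).real {x | kernelSum w x ≤ t} := by
    rw [← integral_indIic hL4.1.aemeasurable, ← integral_indIic hS.1.aemeasurable,
      ← hmp.integral_comp_ae (g := fun x => indIic t (kernelSum w x))
      ((measurable_indIic t).comp_aemeasurable hS.1.aemeasurable).aestronglyMeasurable]
    refine integral_congr_ae ?_
    filter_upwards [hWw] with ω hω
    rw [hω]
  have hfin := hw.abs_measure_sub_stdCDF_le_fourth_moment hp hv t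
  rw [Fintype.card_fin] at hfin
  rw [hmeas, hint 4]
  exact hfin
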